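/- Let $V$ be a complex vector space of finite dimension $n$, and let $d,k\ge 1$ be integers. A subspace $U\subseteq V$ is called isotropic with respect to a symmetric or skew-symmetric $d$-linear form $w$ on $V$ if $w(u_1,\dots,u_d)=0$ for all $u_1,\dots,u_d\in U$. A property holds for a generic form in $S^dV^*$ (resp. in $\Lambda^dV^*$) if it holds for all forms in some nonempty Zariski open subset of that space; here the open subset may depend on $V$, $d$ and $k$. For a generic form $w\in S^dV^*$ (resp. $w\in\Lambda^dV^*$), the space $V$ contains a $k$-dimensional subspace isotropic with respect to $w$ if and only if $$n\ \ge\ \frac{\binom{d+k-1}{d}}{k}+k\qquad\Bigl(\text{resp. } n\ \ge\ \frac{\binom{k}{d}}{k}+k\Bigr),$$ with the following exceptions, in which the necessary and sufficient condition for a generic form $w$ is instead: 1. for $w\in S^2V^*$: $n\ge 2k$; 2. for $w\in\Lambda^2V^*$: $n\ge 2k$ if $n$ is even, and $n\ge 2k-1$ if $n$ is odd; 3. for $w\in\Lambda^{n-2}V^*$ with $n$ even, $n\ge 4$: $k\le n-2$; 4. for $w\in\Lambda^3V^*$ with $n=7$: $k\le 4$. -/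

import Mathlib

/-- The space `S^d V*` of symmetric `d`-linear forms on a complex vector space `V`. (In characteristic
zero these are, by polarization, the same as homogeneous polynomials of degree `d` on `V`.) -/
def SymForm (d : ℕ) (V : Type*) [AddCommGroup V] [Module ℂ V] :
    Submodule ℂ (MultilinearMap ℂ (fun _ : Fin d => V) ℂ) where
  carrier := {f | ∀ (σ : Equiv.Perm (Fin d)) (v : Fin d → V), f (fun i => v (σ i)) = f v}
  add_mem' := by
    intro f g hf hg σ v
    rw [add_apply, add_apply, hf σ v, hg σ v]
  zero_mem' := by
    intro σ v
    rfl
  smul_mem' := by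
    intro c f hf σ v
    rw [smul_apply, smul_apply, hf σ v]

/-- A subspace `U` is isotropic with respect to a `d`-linear form `w` if the restriction of `w`
to `U` is zero. -/
def IsIsotropic {d : ℕ} {V : Type*} [AddCommGroup V] [Module ℂ V]
    (w : MultilinearMap ℂ (fun _ : Fin d => V) ℂ) (U : Submodule ℂ V) : Prop :=
  ∀ v : Fin d → V, (∀ i, v i ∈ U) → w v = 0

/-- `V` contains a `k`-dimensional subspace that is isotropic with respect to `w`. -/
def HasIsotropicSubspace {d : ℕ} {V : Type*} [AddCommGroup V] [Module ℂ V]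
    (w : MultilinearMap ℂ (fun _ : Fin d => V) ℂ) (k : ℕ) : Prop :=
  ∃ U : Submodule ℂ V, Module.finrank ℂ U = k ∧ IsIsotropic w U

/-- A property holds for a generic element of a finite-dimensional complex vector space `W` if it
holds on a nonempty Zariski open subset of `W`; equivalently, since every nonempty Zariski open
subset contains a nonempty principal one, if there is a polynomial function `P` on `W` (a polynomial
expression in linear functionals) that is not identically zero such that the property holds wherever
`P` does not vanish. -/
def HoldsGenerically {W : Type*} [AddCommGroup W] [Module ℂ W] (p : W → Prop) : Prop :=
  ∃ P : MvPolynomial (Module.Dual ℂ W) ℂ,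
    (∃ w₀ : W, MvPolynomial.eval (fun φ : Module.Dual ℂ W => φ w₀) P ≠ 0) ∧
      ∀ w : W, MvPolynomial.eval (fun φ : Module.Dual ℂ W => φ w) P ≠ 0 → p w

/-! In coordinates, forms become symmetric or skew arrays (`symArray`), and the span of the rows of
`A` is isotropic exactly when `pull A t = 0`. The forms with an isotropic `k`-space are the
pullbacks, under arbitrary endomorphisms, of forms vanishing on a fixed coordinate `k`-space. They
are thus the image of a polynomial map, which by Chevalley either generically misses or generically
contains a form. They are also a closed set, since orthonormal frames form a compact set. Hence
`forall_hasIsotropicRows_or_generically_not`: either every form has such a subspace, or a generic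
form has none. It remains to treat all forms when the numerical condition holds, and to exhibit one
bad form when it fails.

Bad forms: isotropy imposes as many conditions as there are independent coefficients of forms in `k`
variables, on a Grassmannian of dimension `k (n - k)`. `exists_not_hasIsotropicRows` turns this
count into a comparison of transcendence degrees over `ℚ`.

Existence, in degree `d + 1` with `n = k + m`: take a form `t₀` linear in the `m` extra variables,
with coefficient arrays `f j`. Its restriction to the graph of `φ : ℂ^k → ℂ^m` is linear in `φ`. If
this linear map is onto, the implicit function argument gives isotropic graphs for all forms near
`t₀`, hence, by the dichotomy, isotropic subspaces for all forms. Dually, surjectivity says that no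
nonzero `g` is annihilated by all the `f j` (`HasSeparatingArrays`). The `g` whose first contraction
has rank `r` depend on `r (k - r) + formDim ε (d + 1) r` parameters, and annihilation imposes `r m`
conditions. In degree at least three, dividing by `r` makes this comparison convex in `r`, so only
the extreme ranks matter. The largest, `r = k`, is the inequality of the theorem; the smallest is
automatic in the symmetric case, and in the skew case can fail only in degree `n - 2` or for degree
three in dimension seven.

The bad forms in the exceptional cases are explicit: nondegenerate (or corank one) bilinear forms, a
form of degree `n - 2` built from a perfect pairing of the indices, and the `G₂`-form in dimension
seven. For degree `n - 2` with `n` odd, the same pairing instead supplies a separating array. -/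

/-! ### Images of polynomial maps and generic properties. -/

open MvPolynomial in
/-- Either the image of a polynomial map of affine spaces lies in a hypersurface, or it contains a
nonempty principal open subset. -/
theorem MvPolynomial.image_dichotomy {α β : Type*} [Finite α] [Finite β]
    (F : β → MvPolynomial α ℂ) :
    (∃ P : MvPolynomial β ℂ, P ≠ 0 ∧ ∀ x, eval (fun b => eval x (F b)) P = 0) ∨
      ∃ P : MvPolynomial β ℂ, P ≠ 0 ∧ ∀ y, eval y P ≠ 0 → ∃ x, ∀ b, eval x (F b) = y b := by
  set f : MvPolynomial β ℂ →ₐ[ℂ] MvPolynomial α ℂ := aeval F with hf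
  have hev : ∀ x P, eval (fun b => eval x (F b)) P = eval x (f P) := by
    intro x P
    induction P using MvPolynomial.induction_on with
    | C a => simp [hf]
    | add p q hp hq => simp [hp, hq]
    | mul_X p b hp => simp [hp, hf]
  -- If `f` is injective, the generic point lies in the range on spectra. That range is
  -- constructible, so it contains a locally closed piece through the generic point; such a piece is
  -- a basic open set, and the Nullstellensatz translates back to points.
  by_cases hinj : Function.Injective f
  · right
    have hfp : (f : MvPolynomial β ℂ →+* MvPolynomial α ℂ).FinitePresentation := by
      refine RingHom.FinitePresentation.of_comp_finiteType
        (algebraMap ℂ (MvPolynomial β ℂ)) ?_ ?_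
      · have : (f : MvPolynomial β ℂ →+* MvPolynomial α ℂ).comp (algebraMap ℂ (MvPolynomial β ℂ))
          = algebraMap ℂ (MvPolynomial α ℂ) := f.comp_algebraMap
        rw [this, RingHom.finitePresentation_algebraMap]
        infer_instance
      · rw [RingHom.finiteType_algebraMap]
        infer_instance
    obtain ⟨S, hS⟩ := PrimeSpectrum.exists_constructibleSetData_iff.mpr
      (PrimeSpectrum.isConstructible_range_comap hfp)
    have hbot : (⟨⊥, Ideal.isPrime_bot⟩ : PrimeSpectrum (MvPolynomial β ℂ)) ∈
        Set.range (PrimeSpectrum.comap (f : MvPolynomial β ℂ →+* MvPolynomial α ℂ)) := by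
      refine ⟨⟨⊥, Ideal.isPrime_bot⟩, ?_⟩
      ext P
      simp [Ideal.mem_comap, map_eq_zero_iff f hinj]
    rw [← hS, PrimeSpectrum.ConstructibleSetData.toSet] at hbot
    simp only [Set.mem_iUnion] at hbot
    obtain ⟨C, hC, hbC⟩ := hbot
    rw [PrimeSpectrum.BasicConstructibleSetData.toSet] at hbC
    have hg : ∀ i, C.g i = 0 := by
      intro i
      have := hbC.1
      rw [PrimeSpectrum.mem_zeroLocus] at this
      simpa using this ⟨i, rfl⟩
    have hCf : C.f ≠ 0 := by
      intro h
      apply hbC.2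
      rw [PrimeSpectrum.mem_zeroLocus]
      simp [h]
    refine ⟨C.f, hCf, fun y hy => ?_⟩
    have hmax : (vanishingIdeal ℂ {y} : Ideal (MvPolynomial β ℂ)).IsMaximal :=
      isMaximal_iff_eq_vanishingIdeal_singleton.mpr ⟨y, rfl⟩
    have hmem : (⟨vanishingIdeal ℂ {y}, hmax.isPrime⟩ : PrimeSpectrum (MvPolynomial β ℂ)) ∈
        Set.range (PrimeSpectrum.comap (f : MvPolynomial β ℂ →+* MvPolynomial α ℂ)) := by
      rw [← hS, PrimeSpectrum.ConstructibleSetData.toSet]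
      simp only [Set.mem_iUnion]
      refine ⟨C, hC, ?_⟩
      rw [PrimeSpectrum.BasicConstructibleSetData.toSet]
      refine ⟨?_, ?_⟩
      · rw [PrimeSpectrum.mem_zeroLocus]
        rintro _ ⟨i, rfl⟩
        rw [hg i]
        exact Ideal.zero_mem _
      · rw [PrimeSpectrum.mem_zeroLocus]
        intro h
        have := h (Set.mem_singleton C.f)
        rw [SetLike.mem_coe, mem_vanishingIdeal_singleton_iff] at this
        exact hy (by simpa [MvPolynomial.coe_aeval_eq_eval] using this)
    obtain ⟨q, hq⟩ := hmem
    have hq' : Ideal.comap (f : MvPolynomial β ℂ →+* MvPolynomial α ℂ) q.asIdeal =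
        vanishingIdeal ℂ {y} := congrArg PrimeSpectrum.asIdeal hq
    -- The prime `q` over `y` need not be maximal, but any maximal ideal above it still contains the
    -- equations of the fibre over `y`.
    obtain ⟨M, hM, hqM⟩ := Ideal.exists_le_maximal q.asIdeal q.isPrime.ne_top
    obtain ⟨x, rfl⟩ := isMaximal_iff_eq_vanishingIdeal_singleton.mp hM
    refine ⟨x, fun b => ?_⟩
    have h1 : X b - MvPolynomial.C (y b) ∈ vanishingIdeal ℂ {y} := by
      rw [mem_vanishingIdeal_singleton_iff]
      simp
    rw [← hq', Ideal.mem_comap] at h1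
    have h2 := hqM h1
    rw [mem_vanishingIdeal_singleton_iff] at h2
    simpa [hf, sub_eq_zero, MvPolynomial.coe_aeval_eq_eval] using h2
  · left
    rw [injective_iff_map_eq_zero] at hinj
    push Not at hinj
    obtain ⟨P, hP, hP0⟩ := hinj
    exact ⟨P, hP0, fun x => by rw [hev, hP, map_zero]⟩

section Generic

variable {W W' : Type*} [AddCommGroup W] [Module ℂ W] [AddCommGroup W'] [Module ℂ W']

theorem holdsGenerically_of_forall {p : W → Prop} (h : ∀ w, p w) : HoldsGenerically p :=
  ⟨1, ⟨0, by simp⟩, fun w _ => h w⟩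

theorem HoldsGenerically.mono {p q : W → Prop} (h : HoldsGenerically p) (hpq : ∀ w, p w → q w) :
    HoldsGenerically q := by
  obtain ⟨P, hP, h⟩ := h
  exact ⟨P, hP, fun w hw => hpq w (h w hw)⟩

theorem HoldsGenerically.comp_linearEquiv {p : W' → Prop} (h : HoldsGenerically p)
    (e : W ≃ₗ[ℂ] W') : HoldsGenerically fun w => p (e w) := by
  obtain ⟨P, ⟨w₀, hw₀⟩, h⟩ := h
  have key : ∀ w, MvPolynomial.eval (fun φ : Module.Dual ℂ W => φ w)
      (MvPolynomial.rename (fun φ : Module.Dual ℂ W' => φ ∘ₗ (e : W →ₗ[ℂ] W')) P) =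
      MvPolynomial.eval (fun φ : Module.Dual ℂ W' => φ (e w)) P := by
    intro w
    rw [MvPolynomial.eval_rename]
    rfl
  refine ⟨MvPolynomial.rename (fun φ => φ ∘ₗ (e : W →ₗ[ℂ] W')) P, ⟨e.symm w₀, ?_⟩, fun w hw => ?_⟩
  · rw [key]
    simpa using hw₀
  · rw [key] at hw
    exact h _ hw

open Polynomial in
/-- A generic property is dense along lines, so that a closed generic property always holds. -/
theorem HoldsGenerically.forall_of_isClosed [TopologicalSpace W] [ContinuousAdd W]
    [ContinuousSMul ℂ W] {p : W → Prop} (h : HoldsGenerically p) (hc : IsClosed {w | p w}) (w : W) :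
    p w := by
  obtain ⟨P, ⟨w₀, hw₀⟩, h⟩ := h
  -- `Q` is `P` on the line from `w` (at 0) to `w₀` (at 1). Its value at 1 is nonzero, so the
  -- property holds for all but finitely many parameters.
  set Q : ℂ[X] := MvPolynomial.aeval
    (fun φ : Module.Dual ℂ W => Polynomial.C (φ w) + Polynomial.X * Polynomial.C (φ w₀ - φ w)) P
    with hQ
  have hev : ∀ t : ℂ, Q.eval t =
      MvPolynomial.eval (fun φ : Module.Dual ℂ W => φ (w + t • (w₀ - w))) P := by
    intro t
    have := MvPolynomial.map_aeval
      (fun φ : Module.Dual ℂ W => Polynomial.C (φ w) + Polynomial.X * Polynomial.C (φ w₀ - φ w))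
      (Polynomial.evalRingHom t) P
    rw [hQ]
    change (Polynomial.evalRingHom t) _ = _
    rw [this, MvPolynomial.coe_eval₂Hom, MvPolynomial.eval, MvPolynomial.coe_eval₂Hom]
    congr 1
    · ext <;> simp
    · ext φ
      simp
  have hQ0 : Q ≠ 0 := by
    intro h0
    apply hw₀
    have := hev 1
    rw [h0] at this
    simpa using this.symm
  have hdense : Dense {t : ℂ | Q.eval t ≠ 0} := by
    have : {t : ℂ | Q.eval t ≠ 0} = (↑Q.roots.toFinset)ᶜ := by
      ext t
      simp [hQ0]
    rw [this]
    exact (Finset.finite_toSet _).countable.dense_compl ℂ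
  have hcl : IsClosed {t : ℂ | p (w + t • (w₀ - w))} :=
    hc.preimage (f := fun t : ℂ => w + t • (w₀ - w)) (by fun_prop)
  have hsub : {t : ℂ | Q.eval t ≠ 0} ⊆ {t : ℂ | p (w + t • (w₀ - w))} := by
    intro t ht
    exact h _ (by rw [← hev]; exact ht)
  have := hcl.closure_subset_iff.mpr hsub (hdense 0)
  simpa using this

/-- Functions on `ℂ^α` given by a polynomial. -/
def IsPolyFun {α : Type*} (h : (α → ℂ) → ℂ) : Prop :=
  ∃ p : MvPolynomial α ℂ, ∀ x, h x = MvPolynomial.eval x p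

namespace IsPolyFun

variable {α κ : Type*}

theorem const (c : ℂ) : IsPolyFun fun _ : α → ℂ => c := ⟨MvPolynomial.C c, fun x => by simp⟩

theorem coord (a : α) : IsPolyFun fun x : α → ℂ => x a := ⟨MvPolynomial.X a, fun x => by simp⟩

theorem mul {f g : (α → ℂ) → ℂ} (hf : IsPolyFun f) (hg : IsPolyFun g) :
    IsPolyFun fun x => f x * g x := by
  obtain ⟨p, hp⟩ := hf
  obtain ⟨q, hq⟩ := hg
  exact ⟨p * q, fun x => by simp [hp, hq]⟩

theorem sum {f : κ → (α → ℂ) → ℂ} (s : Finset κ) (hf : ∀ i, IsPolyFun (f i)) :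
    IsPolyFun fun x => ∑ i ∈ s, f i x := by
  choose p hp using hf
  exact ⟨∑ i ∈ s, p i, fun x => by simp [hp]⟩

theorem prod {f : κ → (α → ℂ) → ℂ} (s : Finset κ) (hf : ∀ i, IsPolyFun (f i)) :
    IsPolyFun fun x => ∏ i ∈ s, f i x := by
  choose p hp using hf
  exact ⟨∏ i ∈ s, p i, fun x => by simp [hp]⟩

end IsPolyFun

/-- The image of a polynomial map into a finite-dimensional space either generically misses or
generically contains a point. -/
theorem holdsGenerically_range_dichotomy [FiniteDimensional ℂ W] {α : Type*} [Finite α]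
    (Φ : (α → ℂ) → W) (hΦ : ∀ l : Module.Dual ℂ W, IsPolyFun fun x => l (Φ x)) :
    HoldsGenerically (fun w => w ∉ Set.range Φ) ∨ HoldsGenerically fun w => w ∈ Set.range Φ := by
  set b := Module.finBasis ℂ W
  choose F hF using fun i => hΦ (b.coord i)
  have key : ∀ (P : MvPolynomial (Fin (Module.finrank ℂ W)) ℂ) w,
      MvPolynomial.eval (fun φ : Module.Dual ℂ W => φ w) (MvPolynomial.rename b.coord P) =
      MvPolynomial.eval (fun i => b.coord i w) P := by
    intro P w
    rw [MvPolynomial.eval_rename]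
    rfl
  have hne : ∀ P : MvPolynomial (Fin (Module.finrank ℂ W)) ℂ, P ≠ 0 →
      ∃ w, MvPolynomial.eval (fun i => b.coord i w) P ≠ 0 := by
    intro P hP
    by_contra! h
    apply hP
    apply MvPolynomial.funext
    intro x
    have := h (b.equivFun.symm x)
    rw [map_zero, ← this]
    congr 1
    congr 1
    ext i
    rw [b.coord_apply, ← b.equivFun_apply, LinearEquiv.apply_symm_apply]
  rcases MvPolynomial.image_dichotomy F with ⟨P, hP, h⟩ | ⟨P, hP, h⟩
  · left
    refine ⟨MvPolynomial.rename b.coord P, ?_, ?_⟩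
    · simpa only [key] using hne P hP
    · rintro w hw ⟨x, rfl⟩
      rw [key] at hw
      apply hw
      rw [← h x]
      simp only [hF]
  · right
    refine ⟨MvPolynomial.rename b.coord P, ?_, ?_⟩
    · simpa only [key] using hne P hP
    · intro w hw
      rw [key] at hw
      obtain ⟨x, hx⟩ := h _ hw
      refine ⟨x, b.ext_elem fun i => ?_⟩
      have := hF i x
      rw [hx] at this
      simpa using this

end Generic

/-! ### Symmetric and skew arrays and their pullbacks. -/

/-- The sign character of the permutations of `Fin d` if `ε` is true, the trivial character
otherwise. -/
noncomputable def permChar (ε : Bool) {d : ℕ} (σ : Equiv.Perm (Fin d)) : ℂ :=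
  if ε then ((Equiv.Perm.sign σ : ℤˣ) : ℤ) else 1

section permChar

variable (ε : Bool) {d : ℕ} (σ τ : Equiv.Perm (Fin d))

theorem permChar_mul : permChar ε (σ * τ) = permChar ε σ * permChar ε τ := by
  cases ε <;> simp [permChar]

theorem permChar_one : permChar ε (1 : Equiv.Perm (Fin d)) = 1 := by
  cases ε <;> simp [permChar]

theorem permChar_mul_self : permChar ε σ * permChar ε σ = 1 := by
  cases ε
  · simp [permChar]
  · rcases Int.units_eq_one_or (Equiv.Perm.sign σ) with h | h <;> simp [permChar, h]

theorem permChar_inv : permChar ε σ⁻¹ = permChar ε σ := by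
  cases ε <;> simp [permChar]

theorem permChar_eq_one_or : permChar ε σ = 1 ∨ permChar ε σ = -1 := by
  have := permChar_mul_self ε σ
  rcases mul_self_eq_one_iff.mp this with h | h <;> simp [h]

end permChar

/-- Arrays indexed by `d`-tuples, symmetric or (if `ε` is true) skew-symmetric. -/
def symArray (ε : Bool) (d : ℕ) (ι : Type*) : Submodule ℂ ((Fin d → ι) → ℂ) where
  carrier := {t | ∀ (σ : Equiv.Perm (Fin d)) (I : Fin d → ι), t (I ∘ σ) = permChar ε σ * t I}
  add_mem' := by
    intro s t hs ht σ I
    simp only [Pi.add_apply, hs σ I, ht σ I, mul_add]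
  zero_mem' := by
    intro σ I
    simp
  smul_mem' := by
    intro c t ht σ I
    simp only [Pi.smul_apply, ht σ I, smul_eq_mul]
    ring

section pull

variable {d : ℕ} {ι κ l : Type*} [Fintype ι]

/-- The coordinate array, in the vectors `A i`, of the form with coordinate array `t`. -/
def pull (A : κ → ι → ℂ) : ((Fin d → ι) → ℂ) →ₗ[ℂ] ((Fin d → κ) → ℂ) where
  toFun t := fun J => ∑ I : Fin d → ι, (∏ s, A (J s) (I s)) * t I
  map_add' s t := by
    ext J
    simp [mul_add, Finset.sum_add_distrib]
  map_smul' c t := by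
    ext J
    simp only [Pi.smul_apply, smul_eq_mul, Finset.mul_sum, RingHom.id_apply]
    exact Finset.sum_congr rfl fun I _ => by ring

theorem pull_apply (A : κ → ι → ℂ) (t : (Fin d → ι) → ℂ) (J : Fin d → κ) :
    pull A t J = ∑ I : Fin d → ι, (∏ s, A (J s) (I s)) * t I := rfl

theorem pull_pull [Fintype κ] (A : l → κ → ℂ) (B : κ → ι → ℂ) (t : (Fin d → ι) → ℂ) :
    pull A (pull B t) = pull (fun i j => ∑ x, A i x * B x j) t := by
  classical
  ext L
  simp only [pull_apply, Finset.prod_univ_sum, Fintype.piFinset_univ,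
    Finset.mul_sum, Finset.sum_mul]
  rw [Finset.sum_comm]
  refine Finset.sum_congr rfl fun I _ => Finset.sum_congr rfl fun J _ => ?_
  rw [Finset.prod_mul_distrib]
  ring

theorem pull_single [DecidableEq ι] (t : (Fin d → ι) → ℂ) :
    pull (fun i => Pi.single i (1 : ℂ)) t = t := by
  ext J
  rw [pull_apply, Finset.sum_eq_single J]
  · simp
  · intro I _ hI
    obtain ⟨s, hs⟩ := Function.ne_iff.mp hI
    rw [Finset.prod_eq_zero (Finset.mem_univ s), zero_mul]
    exact Pi.single_eq_of_ne hs 1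
  · simp

theorem pull_mem (A : κ → ι → ℂ) {ε : Bool} {t : (Fin d → ι) → ℂ} (ht : t ∈ symArray ε d ι) :
    pull A t ∈ symArray ε d κ := by
  intro σ J
  simp only [pull_apply, Finset.mul_sum]
  rw [← Equiv.sum_comp (σ.symm.arrowCongr (Equiv.refl ι))]
  refine Finset.sum_congr rfl fun I _ => ?_
  have h1 : (σ.symm.arrowCongr (Equiv.refl ι)) I = I ∘ σ := by
    ext s
    simp [Equiv.arrowCongr]
  rw [h1, ht σ I]
  have : ∏ s, A ((J ∘ σ) s) ((I ∘ σ) s) = ∏ s, A (J s) (I s) :=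
    Equiv.prod_comp σ fun s => A (J s) (I s)
  rw [this]
  ring

/-- The form with coordinate array `t` has an isotropic subspace of dimension `k`. -/
def HasIsotropicRows (t : (Fin d → ι) → ℂ) (k : ℕ) : Prop :=
  ∃ A : Fin k → ι → ℂ, LinearIndependent ℂ A ∧ pull A t = 0

theorem HasIsotropicRows.mono {t : (Fin d → ι) → ℂ} {k k' : ℕ} (h : HasIsotropicRows t k)
    (hk : k' ≤ k) : HasIsotropicRows t k' := by
  obtain ⟨A, hA, h0⟩ := h
  refine ⟨fun i => A (Fin.castLE hk i), hA.comp _ (Fin.castLE_injective hk), ?_⟩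
  ext J
  exact congrFun h0 fun s => Fin.castLE hk (J s)

theorem HasIsotropicRows.le_card {t : (Fin d → ι) → ℂ} {k : ℕ} (h : HasIsotropicRows t k) :
    k ≤ Fintype.card ι := by
  obtain ⟨A, hA, -⟩ := h
  simpa using hA.fintype_card_le_finrank

theorem hasIsotropicRows_of_submodule {t : (Fin d → ι) → ℂ} {k : ℕ} (U : Submodule ℂ (ι → ℂ))
    (hU : k ≤ Module.finrank ℂ U)
    (h : ∀ A : Fin k → ι → ℂ, (∀ i, A i ∈ U) → pull A t = 0) : HasIsotropicRows t k := by
  set b := Module.finBasis ℂ U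
  refine ⟨fun i => (b (Fin.castLE hU i) : ι → ℂ), ?_, h _ fun i => (b _).2⟩
  exact (b.linearIndependent.comp _ (Fin.castLE_injective hU)).map' U.subtype U.ker_subtype

/-- The vanishing of `pull A t` depends only on the span of the vectors `A i`. -/
theorem pull_eq_zero_of_mem_span [Fintype l] {A : l → ι → ℂ} {B : κ → ι → ℂ}
    {t : (Fin d → ι) → ℂ} (h : pull A t = 0) (hB : ∀ i, B i ∈ Submodule.span ℂ (Set.range A)) :
    pull B t = 0 := by
  choose C hC using fun i => (Submodule.mem_span_range_iff_exists_fun ℂ).mp (hB i)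
  have : B = fun i j => ∑ x, C i x * A x j := by
    ext i j
    rw [← hC i]
    simp
  rw [this, ← pull_pull, h, map_zero]

end pull

/-! ### Compactness: having an isotropic subspace is a closed condition. -/

section closed

variable {d : ℕ} {ι : Type*} [Fintype ι]

/-- The families of `k` vectors which are orthonormal for the standard Hermitian product. -/
def orthonormalRows (k : ℕ) (ι : Type*) [Fintype ι] : Set (Fin k → ι → ℂ) :=
  {A | ∀ i j, ∑ l, A i l * star (A j l) = if i = j then 1 else 0}

theorem linearIndependent_of_mem_orthonormalRows {k : ℕ} {A : Fin k → ι → ℂ}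
    (hA : A ∈ orthonormalRows k ι) : LinearIndependent ℂ A := by
  rw [Fintype.linearIndependent_iff]
  intro g hg i
  have h1 : ∑ l, (∑ j, g j • A j) l * star (A i l) = g i := by
    simp only [Finset.sum_apply, Pi.smul_apply, smul_eq_mul, Finset.sum_mul]
    rw [Finset.sum_comm]
    simp only [mul_assoc, ← Finset.mul_sum, hA _ i]
    simp
  rw [← h1, hg]
  simp

/-- Isotropy depends only on the span, so an orthonormal basis of the span may replace the given
frame. This makes the parameter space compact. -/
theorem hasIsotropicRows_iff_orthonormal (t : (Fin d → ι) → ℂ) (k : ℕ) :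
    HasIsotropicRows t k ↔ ∃ A ∈ orthonormalRows k ι, pull A t = 0 := by
  constructor
  · rintro ⟨A, hA, h⟩
    set e := WithLp.linearEquiv 2 ℂ (ι → ℂ)
    set v : Fin k → EuclideanSpace ℂ ι := fun i => e.symm (A i) with hv
    have hvi : LinearIndependent ℂ v := hA.map' e.symm.toLinearMap e.symm.ker
    have hfr : Module.finrank ℂ (Submodule.span ℂ (Set.range v)) = k := by
      rw [finrank_span_eq_card hvi, Fintype.card_fin]
    set b := (stdOrthonormalBasis ℂ (Submodule.span ℂ (Set.range v))).reindex (finCongr hfr)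
    refine ⟨fun i => e (b i : EuclideanSpace ℂ ι), ?_, ?_⟩
    · intro i j
      have h1 := orthonormal_iff_ite.mp b.orthonormal j i
      rw [Submodule.coe_inner, EuclideanSpace.inner_eq_star_dotProduct] at h1
      simp only [eq_comm (a := i), ← h1]
      rfl
    · refine pull_eq_zero_of_mem_span h fun i => ?_
      have h1 : (b i : EuclideanSpace ℂ ι) ∈ Submodule.span ℂ (Set.range v) := (b i).2
      have h2 := Submodule.mem_map_of_mem (f := e.toLinearMap) h1
      rw [Submodule.map_span, ← Set.range_comp] at h2
      have h3 : (⇑e.toLinearMap ∘ v) = A := by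
        ext i j
        simp [hv]
      rw [h3] at h2
      exact h2
  · rintro ⟨A, hA, h⟩
    exact ⟨A, linearIndependent_of_mem_orthonormalRows hA, h⟩

theorem isCompact_orthonormalRows (k : ℕ) : IsCompact (orthonormalRows k ι) := by
  have hK : IsCompact (Set.pi Set.univ fun _ : Fin k =>
      Set.pi Set.univ fun _ : ι => Metric.closedBall (0 : ℂ) 1) :=
    isCompact_univ_pi fun _ => isCompact_univ_pi fun _ => isCompact_closedBall 0 1
  refine hK.of_isClosed_subset ?_ ?_
  · simp only [orthonormalRows, Set.ofPred_forall]
    exact isClosed_iInter fun i => isClosed_iInter fun j =>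
      isClosed_eq (by fun_prop) continuous_const
  · intro A hA i _ j _
    have h1 := hA i i
    simp only [RCLike.star_def, Complex.mul_conj, if_true] at h1
    norm_cast at h1
    have h2 : Complex.normSq (A i j) ≤ 1 := by
      rw [← h1]
      exact Finset.single_le_sum (f := fun j => Complex.normSq (A i j))
        (fun j _ => Complex.normSq_nonneg _) (Finset.mem_univ j)
    rw [mem_closedBall_zero_iff]
    rw [Complex.normSq_eq_norm_sq] at h2
    nlinarith [norm_nonneg (A i j)]

/-- The set is the projection of a closed incidence set along the compact factor of orthonormal
frames. -/
theorem isClosed_hasIsotropicRows (k : ℕ) :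
    IsClosed {t : (Fin d → ι) → ℂ | HasIsotropicRows t k} := by
  have : CompactSpace (orthonormalRows k ι) :=
    isCompact_iff_compactSpace.mp (isCompact_orthonormalRows k)
  have hC : IsClosed {p : orthonormalRows k ι × ((Fin d → ι) → ℂ) | pull p.1.1 p.2 = 0} := by
    refine isClosed_eq ?_ continuous_const
    refine continuous_pi fun J => ?_
    simp only [pull_apply]
    refine continuous_finsetSum _ fun I _ => Continuous.mul ?_ (by fun_prop)
    refine continuous_finsetProd _ fun s _ => ?_
    exact (continuous_apply_apply (J s) (I s)).comp (continuous_subtype_val.comp continuous_fst)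
  have := isClosedMap_snd_of_compactSpace _ hC
  convert this using 1
  ext t
  simp only [Set.mem_ofPred_eq, Set.mem_image, Prod.exists, exists_eq_right, Subtype.exists]
  rw [hasIsotropicRows_iff_orthonormal]
  simp

end closed

/-! ### The dichotomy: all forms, or generically none. -/

section dichotomy

variable {d : ℕ} {ι : Type*} [Fintype ι] [DecidableEq ι]

/-- The preimage of a `k`-dimensional subspace under an endomorphism has dimension at least `k`.
Hence `g` need not be invertible, and all matrices may serve as parameters. -/
theorem hasIsotropicRows_pull {k : ℕ} (e : Fin k ↪ ι) (g : ι → ι → ℂ) {t : (Fin d → ι) → ℂ}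
    (ht : ∀ I : Fin d → ι, (∀ s, I s ∈ Set.range e) → t I = 0) : HasIsotropicRows (pull g t) k := by
  classical
  set L : (ι → ℂ) →ₗ[ℂ] ({i // i ∉ Set.range e} → ℂ) :=
    (LinearMap.funLeft ℂ ℂ Subtype.val) ∘ₗ Fintype.linearCombination ℂ g with hL
  have hfr : k ≤ Module.finrank ℂ (LinearMap.ker L) := by
    have h1 := L.finrank_range_add_finrank_ker
    have h2 := (LinearMap.range L).finrank_le
    have h3 : Fintype.card {i // i ∉ Set.range e} = Fintype.card ι - k := by
      rw [Fintype.card_subtype_compl]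
      congr 1
      have : Fintype.card (Set.range e) = k := by
        rw [Set.card_range_of_injective e.injective, Fintype.card_fin]
      convert this
    have h4 : k ≤ Fintype.card ι := by simpa using Fintype.card_le_of_embedding e
    rw [Module.finrank_fintype_fun_eq_card] at h1 h2
    omega
  refine hasIsotropicRows_of_submodule _ hfr fun A hA => ?_
  rw [pull_pull]
  ext J
  rw [pull_apply]
  refine Finset.sum_eq_zero fun I _ => ?_
  by_cases hI : ∀ s, I s ∈ Set.range e
  · rw [ht I hI, mul_zero]
  · push Not at hI
    obtain ⟨s, hs⟩ := hI
    rw [Finset.prod_eq_zero (Finset.mem_univ s), zero_mul]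
    have := congrFun (LinearMap.mem_ker.mp (hA (J s))) ⟨I s, hs⟩
    simpa [hL, Fintype.linearCombination_apply, LinearMap.funLeft] using this

theorem exists_left_inverse_extending_rows {k : ℕ} (e : Fin k ↪ ι) {A : Fin k → ι → ℂ}
    (hA : LinearIndependent ℂ A) : ∃ M N : ι → ι → ℂ,
      (fun i j => ∑ x, N i x * M x j) = (fun i => Pi.single i (1 : ℂ)) ∧ ∀ i, M (e i) = A i := by
  classical
  set b := Module.Basis.sumExtend hA
  have : Finite (Module.Basis.sumExtendIndex hA) := by
    have : Finite (Fin k ⊕ Module.Basis.sumExtendIndex hA) := Module.Finite.finite_basis b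
    exact Finite.of_injective (Sum.inr : _ → Fin k ⊕ Module.Basis.sumExtendIndex hA)
      Sum.inr_injective
  have := Fintype.ofFinite (Module.Basis.sumExtendIndex hA)
  have hcard : Fintype.card (Module.Basis.sumExtendIndex hA) =
      Fintype.card ((Set.range e)ᶜ : Set ι) := by
    have h1 := Module.finrank_eq_card_basis b
    have h2 := Fintype.card_congr (Equiv.Set.sumCompl (Set.range e))
    rw [Fintype.card_sum, Set.card_range_of_injective e.injective] at h2
    rw [Module.finrank_fintype_fun_eq_card, Fintype.card_sum] at h1
    omega
  set E : Fin k ⊕ Module.Basis.sumExtendIndex hA ≃ ι :=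
    (Equiv.sumCongr (Equiv.ofInjective e e.injective) (Fintype.equivOfCardEq hcard)).trans
      (Equiv.Set.sumCompl (Set.range e)) with hE
  set c := b.reindex E with hc
  refine ⟨fun i => c i, fun i j => c.repr (Pi.single i 1) j, ?_, fun i => ?_⟩
  · ext i j
    have := congrFun (c.sum_repr (Pi.single i 1)) j
    rw [Finset.sum_apply] at this
    exact this
  · have h1 : E (Sum.inl i) = e i := by simp [hE]
    rw [← h1]
    change c (E (Sum.inl i)) = A i
    rw [hc, Module.Basis.reindex_apply, Equiv.symm_apply_apply]
    simp only [b, Module.Basis.sumExtend, Module.Basis.coe_reindex, Module.Basis.coe_extend,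
      Function.comp_apply]
    rfl

/-- If some form of the given type does not have an isotropic subspace of dimension `k`, then a
generic form does not. -/
theorem forall_hasIsotropicRows_or_generically_not (ε : Bool) (k : ℕ) :
    (∀ t : symArray ε d ι, HasIsotropicRows (t : (Fin d → ι) → ℂ) k) ∨
      HoldsGenerically fun t : symArray ε d ι => ¬ HasIsotropicRows (t : (Fin d → ι) → ℂ) k := by
  classical
  by_cases hk : k ≤ Fintype.card ι
  swap
  · right
    exact holdsGenerically_of_forall fun t h => hk h.le_card
  obtain ⟨e⟩ : Nonempty (Fin k ↪ ι) := Function.Embedding.nonempty_of_card_le (by simpa using hk)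
  set T₀ : Submodule ℂ ((Fin d → ι) → ℂ) := symArray ε d ι ⊓
    ⨅ I : {I : Fin d → ι // ∀ s, I s ∈ Set.range e}, LinearMap.ker (LinearMap.proj I.1) with hT₀
  have hmem : ∀ t, t ∈ T₀ ↔ t ∈ symArray ε d ι ∧
      ∀ I : Fin d → ι, (∀ s, I s ∈ Set.range e) → t I = 0 := by
    intro t
    simp only [hT₀, Submodule.mem_inf, Submodule.mem_iInf, Subtype.forall, LinearMap.mem_ker,
      LinearMap.proj_apply]
  set b := Module.finBasis ℂ T₀
  set t₀ : ((ι × ι) ⊕ Fin (Module.finrank ℂ T₀) → ℂ) → T₀ := fun x =>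
    ∑ c, x (Sum.inr c) • b c with ht₀
  -- The parameters are a matrix and the coordinates of a form in `T₀`. The image is exactly the set
  -- of forms with an isotropic `k`-space: completing an isotropic frame to a basis gives the
  -- matrix.
  set Φ : ((ι × ι) ⊕ Fin (Module.finrank ℂ T₀) → ℂ) → symArray ε d ι := fun x =>
    ⟨pull (fun i j => x (Sum.inl (i, j))) (t₀ x : (Fin d → ι) → ℂ),
      pull_mem _ ((hmem _).mp (t₀ x).2).1⟩ with hΦ
  have hrange : ∀ t : symArray ε d ι,
      t ∈ Set.range Φ ↔ HasIsotropicRows (t : (Fin d → ι) → ℂ) k := by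
    intro t
    constructor
    · rintro ⟨x, rfl⟩
      exact hasIsotropicRows_pull e _ ((hmem _).mp (t₀ x).2).2
    · rintro ⟨A, hA, h⟩
      obtain ⟨M, N, hNM, hM⟩ := exists_left_inverse_extending_rows e hA
      have h0 : pull M (t : (Fin d → ι) → ℂ) ∈ T₀ := by
        rw [hmem]
        refine ⟨pull_mem M t.2, fun I hI => ?_⟩
        choose J hJ using hI
        refine Eq.trans ?_ (congrFun h J)
        rw [pull_apply, pull_apply]
        refine Finset.sum_congr rfl fun L _ => ?_
        congr 1
        refine Finset.prod_congr rfl fun s _ => ?_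
        rw [← hJ s, hM]
      refine ⟨Sum.elim (fun p => N p.1 p.2) fun c => b.repr ⟨_, h0⟩ c, ?_⟩
      ext1
      have h1 : t₀ (Sum.elim (fun p => N p.1 p.2) fun c => b.repr ⟨_, h0⟩ c) = ⟨_, h0⟩ := by
        simp only [ht₀, Sum.elim_inr]
        exact b.sum_repr _
      simp only [hΦ, h1, Sum.elim_inl]
      change pull N (pull M _) = _
      rw [pull_pull, hNM, pull_single]
  have hpoly : ∀ l : Module.Dual ℂ (symArray ε d ι), IsPolyFun fun x => l (Φ x) := by
    intro l
    obtain ⟨l', hl'⟩ := LinearMap.exists_extend l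
    have h1 : ∀ t : symArray ε d ι, l t = ∑ J, (t : (Fin d → ι) → ℂ) J * l' (Pi.single J 1) := by
      intro t
      rw [← hl', LinearMap.comp_apply, Submodule.subtype_apply]
      conv_lhs => rw [LinearMap.pi_apply_eq_sum_univ l' (t : (Fin d → ι) → ℂ)]
      refine Finset.sum_congr rfl fun J _ => ?_
      rw [smul_eq_mul]
      congr 2
      ext I
      rw [Pi.single_apply]
      simp only [eq_comm]
    simp only [h1, hΦ, pull_apply, ht₀]
    refine IsPolyFun.sum _ fun J => IsPolyFun.mul (IsPolyFun.sum _ fun I => IsPolyFun.mul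
      (IsPolyFun.prod _ fun s => IsPolyFun.coord _) ?_) (IsPolyFun.const _)
    have h2 : ∀ x : (ι × ι) ⊕ Fin (Module.finrank ℂ T₀) → ℂ,
        ((∑ c, x (Sum.inr c) • b c : T₀) : (Fin d → ι) → ℂ) I =
        ∑ c, x (Sum.inr c) * (b c : (Fin d → ι) → ℂ) I := by
      intro x
      simp
    simp only [h2]
    exact IsPolyFun.sum _ fun c => IsPolyFun.mul (IsPolyFun.coord _) (IsPolyFun.const _)
  rcases holdsGenerically_range_dichotomy Φ hpoly with h | h
  · right
    exact h.mono fun t ht h' => ht ((hrange t).mpr h')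
  · left
    refine (h.mono fun t => (hrange t).mp).forall_of_isClosed ?_
    exact (isClosed_hasIsotropicRows k).preimage continuous_subtype_val

end dichotomy

/-! ### Transcendence degree and linear algebra over subfields of the complex numbers. -/

section transcendence

theorem isAlgebraic_of_mem_intermediateField_adjoin {Y : Set ℂ} {z : ℂ}
    (hz : z ∈ IntermediateField.adjoin ℚ Y) : IsAlgebraic (Algebra.adjoin ℚ Y) z := by
  obtain ⟨r, hr, s, hs, rfl⟩ := (IntermediateField.mem_adjoin_iff_div (F := ℚ)).mp hz
  rw [div_eq_mul_inv]
  exact (isAlgebraic_algebraMap (⟨r, hr⟩ : Algebra.adjoin ℚ Y)).mul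
    (isAlgebraic_algebraMap (⟨s, hs⟩ : Algebra.adjoin ℚ Y)).inv

/-- Algebraically independent numbers in a field generated by `m` numbers are at most `m` many. -/
theorem AlgebraicIndependent.card_le_of_mem_adjoin {α β : Type*} [Fintype α] [Fintype β]
    {x : α → ℂ} (hx : AlgebraicIndependent ℚ x) (y : β → ℂ)
    (h : ∀ a, x a ∈ IntermediateField.adjoin ℚ (Set.range y)) :
    Fintype.card α ≤ Fintype.card β := by
  set M := AlgebraicIndependent.matroid ℚ ℂ
  have hI : M.Indep (Set.range x) := AlgebraicIndependent.matroid_indep_iff.mpr hx.to_subtype_range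
  have hcl : Set.range x ⊆ M.closure (Set.range y) := by
    rintro _ ⟨a, rfl⟩
    rw [AlgebraicIndependent.matroid_closure_eq]
    exact isAlgebraic_of_mem_intermediateField_adjoin (h a)
  have h1 := (hI.encard_le_eRk_of_subset hcl).trans
    ((M.eRk_closure_eq _).le.trans (M.eRk_le_encard _))
  rw [← Set.image_univ, ← Set.image_univ, hx.injective.encard_image] at h1
  have h2 := h1.trans (Set.encard_image_le _ _)
  simpa [Set.encard_univ] using h2

/-- A finite transcendence basis over `ℚ` would make `ℂ` countable. -/
theorem exists_algebraicIndependent_rat (α : Type*) [Finite α] :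
    ∃ x : α → ℂ, AlgebraicIndependent ℚ x := by
  obtain ⟨s, hs⟩ := exists_isTranscendenceBasis ℚ ℂ
  have hinf : Set.Infinite s := by
    intro hfin
    have h1 := IsAlgClosed.cardinal_le_max_transcendence_basis _ hs
    rw [Cardinal.mk_complex] at h1
    have := hfin.lt_aleph0
    have h2 : Cardinal.continuum ≤ Cardinal.aleph0 := by
      simpa [this.le] using h1
    exact absurd h2 (not_le.mpr Cardinal.aleph0_lt_continuum)
  have := hinf.to_subtype
  have := Fintype.ofFinite α
  obtain ⟨f⟩ : Nonempty (α ↪ s) :=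
    ⟨(Fintype.equivFin α).toEmbedding.trans ((Fin.valEmbedding).trans (Infinite.natEmbedding s))⟩
  exact ⟨fun a => (f a : ℂ), hs.1.comp f f.injective⟩

/-- The solution of a nonsingular linear system over a subfield lies in this subfield. -/
theorem IntermediateField.mem_of_mulVec_mem {r : Type*} [Fintype r] [DecidableEq r]
    (K : IntermediateField ℚ ℂ) {M : Matrix r r ℂ} (hM : ∀ i j, M i j ∈ K) (hdet : M.det ≠ 0)
    {v : r → ℂ} (hv : ∀ i, (M.mulVec v) i ∈ K) (i : r) : v i ∈ K := by
  set M' : Matrix r r K := Matrix.of fun i j => ⟨M i j, hM i j⟩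
  have hMM' : M'.map (algebraMap K ℂ) = M := by
    ext i j
    rfl
  have hdet' : IsUnit M'.det := by
    rw [isUnit_iff_ne_zero]
    intro h
    apply hdet
    rw [← hMM', ← RingHom.mapMatrix_apply, ← RingHom.map_det, h, map_zero]
  set b : r → K := fun i => ⟨_, hv i⟩
  set w := (M'⁻¹).mulVec b with hw
  have h1 : M'.mulVec w = b := by
    rw [hw, Matrix.mulVec_mulVec, Matrix.mul_nonsing_inv _ hdet', Matrix.one_mulVec]
  have h2 : M.mulVec (fun i => (w i : ℂ)) = M.mulVec v := by
    ext i
    have := congrArg (algebraMap K ℂ) (congrFun h1 i)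
    simp only [Matrix.mulVec, dotProduct, map_sum, map_mul] at this
    exact this
  have h3 := Matrix.mulVec_injective_of_isUnit
    ((Matrix.isUnit_iff_isUnit_det M).mpr (isUnit_iff_ne_zero.mpr hdet)) h2
  rw [← h3]
  exact (w i).2

end transcendence

section spanning

/-- A finite family of vectors has a linearly independent subfamily with the same span. -/
theorem exists_embedding_linearIndependent {κ V : Type*} [Finite κ] [AddCommGroup V] [Module ℂ V]
    (v : κ → V) : ∃ e : Fin (Module.finrank ℂ (Submodule.span ℂ (Set.range v))) ↪ κ,
      LinearIndependent ℂ (v ∘ e) ∧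
        Submodule.span ℂ (Set.range (v ∘ e)) = Submodule.span ℂ (Set.range v) := by
  have : Module.Finite ℂ (Submodule.span ℂ (Set.range v)) :=
    Module.Finite.span_of_finite ℂ (Set.finite_range v)
  obtain ⟨f, hf, hspan, hli⟩ := Submodule.exists_fun_fin_finrank_span_eq ℂ (Set.range v)
  choose e he using hf
  have hfe : v ∘ e = f := funext he
  refine ⟨⟨e, fun i j hij => hli.injective ?_⟩, ?_, ?_⟩
  · rw [← he i, ← he j, hij]
  · change LinearIndependent ℂ (v ∘ e)
    rw [hfe]
    exact hli
  · change Submodule.span ℂ (Set.range (v ∘ e)) = _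
    rw [hfe, hspan]

/-- Linearly independent rows have a nonsingular square submatrix. -/
theorem exists_embedding_det_ne_zero {κ : Type*} [Finite κ] {r : ℕ} {A : Fin r → κ → ℂ}
    (hA : LinearIndependent ℂ A) :
    ∃ e : Fin r ↪ κ, (Matrix.of fun i j => A i (e j)).det ≠ 0 := by
  classical
  have := Fintype.ofFinite κ
  have hrank : Module.finrank ℂ (Submodule.span ℂ (Set.range (Matrix.of A).col)) = r := by
    rw [← Matrix.rank_eq_finrank_span_cols]
    have := hA.rank_matrix (M := Matrix.of A)
    simpa using this
  obtain ⟨e, he, -⟩ := exists_embedding_linearIndependent (Matrix.of A).col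
  refine ⟨(finCongr hrank).symm.toEmbedding.trans e, ?_⟩
  have h1 : LinearIndependent ℂ
      (Matrix.of fun i j => A i ((finCongr hrank).symm.toEmbedding.trans e j)).col :=
    he.comp _ (finCongr hrank).symm.injective
  rw [Matrix.linearIndependent_cols_iff_isUnit, Matrix.isUnit_iff_isUnit_det] at h1
  exact h1.ne_zero

end spanning

/-! ### Independent coordinates of symmetric and skew arrays. -/

section representatives

/-- The dimension of the space of symmetric or (if `ε` is true) skew-symmetric `d`-linear forms in
`k` variables. -/
def formDim (ε : Bool) (d k : ℕ) : ℕ := if ε then k.choose d else (d + k - 1).choose d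

/-- The index tuples at which the values of a symmetric or (if `ε` is true) skew-symmetric array
may be prescribed. -/
def IsBasicTuple (ε : Bool) {d : ℕ} {ι : Type*} [Preorder ι] (J : Fin d → ι) : Prop :=
  if ε then StrictMono J else Monotone J

variable {ε : Bool} {d : ℕ} {ι κ : Type*}

theorem IsBasicTuple.monotone [PartialOrder ι] {J : Fin d → ι} (h : IsBasicTuple ε J) :
    Monotone J := by
  cases ε
  · exact h
  · exact StrictMono.monotone h

theorem isBasicTuple_comp_iff [LinearOrder ι] [LinearOrder κ] {e : κ → ι} (he : StrictMono e)
    {J : Fin d → κ} : IsBasicTuple ε (e ∘ J) ↔ IsBasicTuple ε J := by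
  cases ε
  · exact ⟨fun h i j hij => he.le_iff_le.mp (h hij), fun h => he.monotone.comp h⟩
  · exact ⟨fun h i j hij => he.lt_iff_lt.mp (h hij), fun h => he.comp h⟩

theorem apply_eq_zero_of_not_injective {t : (Fin d → ι) → ℂ} (ht : t ∈ symArray true d ι)
    {I : Fin d → ι} (hI : ¬ Function.Injective I) : t I = 0 := by
  rw [Function.Injective] at hI
  push Not at hI
  obtain ⟨a, b, hab, hne⟩ := hI
  have h1 := ht (Equiv.swap a b) I
  have h2 : I ∘ Equiv.swap a b = I := by
    ext s
    simp only [Function.comp_apply, Equiv.swap_apply_def]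
    split_ifs with h h' <;> simp_all
  rw [h2, permChar, if_pos rfl, Equiv.Perm.sign_swap hne] at h1
  push_cast at h1
  linear_combination h1 / 2

theorem apply_eq_permChar_mul {t : (Fin d → ι) → ℂ} (ht : t ∈ symArray ε d ι)
    (σ : Equiv.Perm (Fin d)) (I : Fin d → ι) : t I = permChar ε σ * t (I ∘ σ) := by
  rw [ht σ I, ← mul_assoc, permChar_mul_self, one_mul]

theorem exists_basic_of_apply_ne_zero [LinearOrder ι] {t : (Fin d → ι) → ℂ}
    (ht : t ∈ symArray ε d ι) {I : Fin d → ι} (hI : t I ≠ 0) :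
    ∃ σ : Equiv.Perm (Fin d), IsBasicTuple ε (I ∘ σ) := by
  refine ⟨Tuple.sort I, ?_⟩
  have hm := Tuple.monotone_sort I
  cases ε
  · exact hm
  · refine hm.strictMono_of_injective ?_
    refine Function.Injective.comp ?_ (Equiv.injective _)
    by_contra h
    exact hI (apply_eq_zero_of_not_injective ht h)

noncomputable instance (r : ℕ) : Fintype {J : Fin d → Fin r // IsBasicTuple ε J} :=
  Fintype.ofFinite _

theorem card_strictMono (d r : ℕ) [Fintype {J : Fin d → Fin r // StrictMono J}] :
    Fintype.card {J : Fin d → Fin r // StrictMono J} = r.choose d := by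
  have h := Finset.card_powersetCard d (Finset.univ : Finset (Fin r))
  rw [Finset.card_univ, Fintype.card_fin] at h
  rw [← h, ← Fintype.card_coe]
  refine Fintype.card_congr (Equiv.ofBijective (fun J => ⟨Finset.univ.map ⟨J.1, J.2.injective⟩,
    by simp [Finset.mem_powersetCard]⟩) ⟨?_, ?_⟩)
  · intro J L hJL
    have h1 : Set.range J.1 = Set.range L.1 := by
      have := congrArg (fun s => (s.1 : Set (Fin r))) hJL
      simpa using this
    exact Subtype.ext ((J.2.range_inj L.2).mp h1)
  · rintro ⟨s, hs⟩
    have hs' := (Finset.mem_powersetCard.mp hs).2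
    refine ⟨⟨s.orderEmbOfFin hs', (s.orderEmbOfFin hs').strictMono⟩, Subtype.ext ?_⟩
    apply Finset.coe_injective
    simp

theorem card_monotone (d r : ℕ) [Fintype {J : Fin d → Fin r // Monotone J}] :
    Fintype.card {J : Fin d → Fin r // Monotone J} = (d + r - 1).choose d := by
  have h := Sym.card_sym_eq_choose (α := Fin r) d
  rw [Fintype.card_fin, Nat.add_comm] at h
  rw [← h]
  refine Fintype.card_congr (Equiv.ofBijective (fun J => ⟨(List.ofFn J.1 : Multiset (Fin r)),
    by simp⟩) ⟨?_, ?_⟩)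
  · intro J L hJL
    have h1 : (List.ofFn J.1 : Multiset (Fin r)) = List.ofFn L.1 := congrArg Subtype.val hJL
    have h2 := (Multiset.coe_eq_coe.mp h1).eq_of_sortedLE J.2.sortedLE_ofFn L.2.sortedLE_ofFn
    exact Subtype.ext (List.ofFn_injective h2)
  · rintro ⟨s, hs⟩
    have hl : (s.sort (· ≤ ·)).length = d := by simp [hs]
    have hsort : (s.sort (· ≤ ·)).SortedLE := (s.pairwise_sort (· ≤ ·)).sortedLE
    refine ⟨⟨fun i => (s.sort (· ≤ ·)).get (i.cast hl.symm), fun i j hij => ?_⟩, ?_⟩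
    · exact hsort.monotone_get hij
    · apply Subtype.ext
      change ((List.ofFn fun i : Fin d => (s.sort (· ≤ ·)).get (i.cast hl.symm) :
        List (Fin r)) : Multiset (Fin r)) = s
      rw [← List.ofFn_congr hl, List.ofFn_get]
      simp

theorem card_isBasicTuple (ε : Bool) (d r : ℕ) :
    Fintype.card {J : Fin d → Fin r // IsBasicTuple ε J} = formDim ε d r := by
  cases ε
  · exact @card_monotone d r (Fintype.ofFinite _)
  · exact @card_strictMono d r (Fintype.ofFinite _)

/-- The sum of the images of an array under all permutations, with signs if `ε` is true. -/
noncomputable def symmetrize (ε : Bool) (c : (Fin d → ι) → ℂ) : (Fin d → ι) → ℂ :=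
  fun I => ∑ σ : Equiv.Perm (Fin d), permChar ε σ * c (I ∘ σ)

theorem symmetrize_mem (ε : Bool) (c : (Fin d → ι) → ℂ) : symmetrize ε c ∈ symArray ε d ι := by
  intro τ I
  rw [symmetrize, symmetrize, Finset.mul_sum, ← Equiv.sum_comp (Equiv.mulLeft τ)
    fun σ => permChar ε τ * (permChar ε σ * c (I ∘ σ))]
  refine Finset.sum_congr rfl fun σ _ => ?_
  rw [Equiv.coe_mulLeft, permChar_mul, ← mul_assoc, ← mul_assoc, permChar_mul_self, one_mul]
  rfl

/-- A symmetric or skew-symmetric array may have any values at basic tuples. -/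
theorem exists_mem_symArray_of_values [LinearOrder ι] (ε : Bool)
    (x : {J : Fin d → ι // IsBasicTuple ε J} → ℂ) :
    ∃ t ∈ symArray ε d ι, ∀ J, t J.1 = x J := by
  classical
  -- `N J` is the character sum over the stabilizer of `J`, the factor by which symmetrization
  -- multiplies a value at a basic tuple. It is nonzero: a count in the symmetric case, and 1 in the
  -- skew case, where the stabilizer is trivial.
  set N : (Fin d → ι) → ℂ := fun J =>
    ∑ σ : Equiv.Perm (Fin d), if J ∘ σ = J then permChar ε σ else 0
  have hN : ∀ J : {J : Fin d → ι // IsBasicTuple ε J}, N J.1 ≠ 0 := by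
    rintro ⟨J, hJ⟩
    cases ε
    · have : N J = ((Finset.univ.filter fun σ : Equiv.Perm (Fin d) => J ∘ σ = J).card : ℂ) := by
        simp [N, permChar]
      rw [this, Nat.cast_ne_zero, ← Nat.pos_iff_ne_zero, Finset.card_pos]
      exact ⟨1, by simp⟩
    · have : N J = 1 := by
        simp only [N]
        rw [Finset.sum_eq_single 1]
        · simp [permChar_one]
        · intro σ _ hσ
          rw [if_neg]
          intro h
          apply hσ
          ext s
          have := StrictMono.injective hJ (congrFun h s)
          rw [this]
          rfl
        · simp
      rw [this]
      exact one_ne_zero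
  refine ⟨symmetrize ε fun J => if h : IsBasicTuple ε J then x ⟨J, h⟩ / N J else 0,
    symmetrize_mem _ _, fun J => ?_⟩
  have h1 : ∀ σ : Equiv.Perm (Fin d), (permChar ε σ *
      if h : IsBasicTuple ε (J.1 ∘ σ) then x ⟨J.1 ∘ σ, h⟩ / N (J.1 ∘ σ) else 0) =
      (if J.1 ∘ σ = J.1 then permChar ε σ else 0) * (x J / N J.1) := by
    intro σ
    by_cases h : J.1 ∘ σ = J.1
    · simp only [h, J.2, dif_pos, if_pos]
    · rw [if_neg h, dif_neg, mul_zero, zero_mul]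
      intro h'
      exact h (Tuple.unique_monotone (σ := σ) (τ := 1) h'.monotone J.2.monotone)
  rw [symmetrize, Finset.sum_congr rfl fun σ _ => h1 σ, ← Finset.sum_mul]
  exact mul_div_cancel₀ _ (hN J)

end representatives

/-! ### Multilinear forms given by arrays, and their radicals. -/

section arrayForm

variable {d : ℕ} {ι κ : Type*} [Fintype ι]

/-- The multilinear form on `ℂ^ι` with a given coordinate array. -/
noncomputable def arrayForm (t : (Fin d → ι) → ℂ) :
    MultilinearMap ℂ (fun _ : Fin d => ι → ℂ) ℂ :=
  ∑ I : Fin d → ι, t I • (MultilinearMap.mkPiAlgebra ℂ (Fin d) ℂ).compLinearMap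
    fun s => LinearMap.proj (I s)

theorem arrayForm_apply (t : (Fin d → ι) → ℂ) (v : Fin d → ι → ℂ) :
    arrayForm t v = ∑ I : Fin d → ι, (∏ s, v s (I s)) * t I := by
  simp [arrayForm, mul_comm]

theorem pull_eq_arrayForm (A : κ → ι → ℂ) (t : (Fin d → ι) → ℂ) (J : Fin d → κ) :
    pull A t J = arrayForm t fun s => A (J s) := by
  rw [pull_apply, arrayForm_apply]

theorem arrayForm_single [DecidableEq ι] (t : (Fin d → ι) → ℂ) (I : Fin d → ι) :
    arrayForm t (fun s => Pi.single (I s) 1) = t I := by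
  have := congrFun (pull_single t) I
  rwa [pull_eq_arrayForm] at this

/-- The hypothesis puts `u` in the radical for the first slot; a cycle moves slot `p` to the front
at the cost of a sign. -/
theorem arrayForm_eq_zero_of_radical {ε : Bool} {g : (Fin (d + 1) → ι) → ℂ}
    (hg : g ∈ symArray ε (d + 1) ι) {u : ι → ℂ}
    (hu : ∀ I : Fin d → ι, ∑ x, u x * g (Fin.cons x I) = 0) {v : Fin (d + 1) → ι → ℂ}
    {p : Fin (d + 1)} (hp : v p = u) : arrayForm g v = 0 := by
  rw [arrayForm_apply, ← Equiv.sum_comp (Fin.insertNthEquiv (fun _ => ι) p),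
    Fintype.sum_prod_type, Finset.sum_comm]
  refine Finset.sum_eq_zero fun I _ => ?_
  have h1 : ∀ x, g (Fin.insertNth (α := fun _ => ι) p x I) =
      permChar ε p.cycleRange.symm * g (Fin.cons x I) := by
    intro x
    rw [apply_eq_permChar_mul hg p.cycleRange.symm (Fin.insertNth p x I)]
    congr 2
    ext j
    simp [Fin.insertNth_apply_cycleRange_symm]
  have h2 : ∀ x, (∏ s, v s (Fin.insertNth (α := fun _ => ι) p x I s)) =
      u x * ∏ s, v (p.succAbove s) (I s) := by
    intro x
    rw [Fin.prod_univ_succAbove _ p]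
    simp [hp]
  change ∑ x, (∏ s, v s (Fin.insertNth (α := fun _ => ι) p x I s)) *
    g (Fin.insertNth (α := fun _ => ι) p x I) = 0
  simp only [h1, h2]
  calc _ = (∏ s, v (p.succAbove s) (I s)) * permChar ε p.cycleRange.symm *
        ∑ x, u x * g (Fin.cons x I) := by
        rw [Finset.mul_sum]
        exact Finset.sum_congr rfl fun x _ => by ring
    _ = 0 := by rw [hu, mul_zero]

/-- The arguments are exchanged one slot at a time, each exchange changing the value by a term with
a radical vector in some slot. -/
theorem arrayForm_congr_mod_radical [DecidableEq ι] {ε : Bool} {g : (Fin (d + 1) → ι) → ℂ}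
    (hg : g ∈ symArray ε (d + 1) ι) {v w : Fin (d + 1) → ι → ℂ}
    (h : ∀ s, ∀ I : Fin d → ι, ∑ x, (v s x - w s x) * g (Fin.cons x I) = 0) :
    arrayForm g v = arrayForm g w := by
  have key : ∀ S : Finset (Fin (d + 1)), arrayForm g (S.piecewise v w) = arrayForm g w := by
    intro S
    induction S using Finset.induction_on with
    | empty => simp
    | insert a S ha ih =>
      rw [Finset.piecewise_insert, ← ih]
      have h1 : v a = (v a - w a) + w a := by simp
      rw [h1, MultilinearMap.map_update_add]
      have h2 : Function.update (S.piecewise v w) a (w a) = S.piecewise v w := by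
        rw [Function.update_eq_self_iff, Finset.piecewise_eq_of_notMem _ _ _ ha]
      rw [h2, arrayForm_eq_zero_of_radical hg (u := v a - w a) (h a) (p := a)
        (Function.update_self _ _ _), zero_add]
  simpa using key Finset.univ

end arrayForm

/-! ### Dimension counts by transcendence degree: bad forms and separating arrays. -/

theorem card_notMem_range {r : ℕ} {κ : Type*} [Fintype κ] (e : Fin r ↪ κ)
    [Fintype {i // i ∉ Set.range e}] :
    Fintype.card {i // i ∉ Set.range e} + r = Fintype.card κ := by
  classical
  have h1 := Fintype.card_subtype_compl (fun i => i ∈ Set.range e)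
  have h2 : Fintype.card {i // i ∈ Set.range e} = r := by
    have := Set.card_range_of_injective e.injective
    rw [Fintype.card_fin] at this
    exact this
  have h3 : r ≤ Fintype.card κ := by simpa using Fintype.card_le_of_embedding e
  have h4 : Fintype.card {i // i ∉ Set.range e} =
      Fintype.card κ - Fintype.card {i // i ∈ Set.range e} := by
    convert h1
  omega

theorem permChar_mem (ε : Bool) {d : ℕ} (σ : Equiv.Perm (Fin d)) (K : IntermediateField ℚ ℂ) :
    permChar ε σ ∈ K := by
  rcases permChar_eq_one_or ε σ with h | h <;> rw [h]
  · exact K.one_mem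
  · exact K.neg_mem K.one_mem

/-- If the space of forms in `k` variables has dimension greater than that of the Grassmannian of
`k`-dimensional subspaces of `ℂ^n`, then some form has no isotropic `k`-dimensional subspace. -/
theorem exists_not_hasIsotropicRows (ε : Bool) {d n k : ℕ}
    (h : k * (n - k) < formDim ε d k) :
    ∃ t ∈ symArray ε d (Fin n), ¬ HasIsotropicRows t k := by
  classical
  obtain ⟨x, hx⟩ := exists_algebraicIndependent_rat {J : Fin d → Fin n // IsBasicTuple ε J}
  obtain ⟨t, ht, htx⟩ := exists_mem_symArray_of_values ε x
  refine ⟨t, ht, ?_⟩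
  rintro ⟨A, hA, hAt⟩
  obtain ⟨e₀, he₀⟩ := exists_embedding_det_ne_zero hA
  -- Sorting the pivot columns makes `e` increasing, so that it carries basic tuples to basic
  -- tuples.
  set π := Tuple.sort e₀
  set e : Fin k ↪ Fin n := π.toEmbedding.trans e₀ with he
  have hmono : StrictMono e :=
    (Tuple.monotone_sort e₀).strictMono_of_injective e.injective
  set M : Matrix (Fin k) (Fin k) ℂ := Matrix.of fun i j => A i (e j) with hM
  have hdet : IsUnit M.det := by
    have h1 : M = (Matrix.of fun i j => A i (e₀ j)).submatrix id π := rfl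
    rw [h1, Matrix.det_permute', isUnit_iff_ne_zero]
    refine mul_ne_zero ?_ he₀
    rcases Int.units_eq_one_or (Equiv.Perm.sign π) with h | h <;> simp [h]
  set N : Fin k → Fin k → ℂ := fun i l => M⁻¹ i l with hN
  -- `B` spans the same subspace as `A`, with the identity matrix in the columns `e`; only `k (n -
  -- k)` entries remain free.
  set B : Fin k → Fin n → ℂ := fun i j => ∑ l, N i l * A l j with hB
  have hBe : ∀ i j, B i (e j) = if i = j then 1 else 0 := by
    intro i j
    have := congrFun (congrFun (Matrix.nonsing_inv_mul M hdet) i) j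
    rw [Matrix.mul_apply, Matrix.one_apply] at this
    exact this
  have hBt : pull B t = 0 := by
    rw [hB, ← pull_pull, hAt, map_zero]
  -- These numbers generate a field containing all the coordinates `x`. There are `k (n - k)` free
  -- entries in place of the `formDim ε d k` coordinates inside the pivot block.
  set y : (Fin k × {j // j ∉ Set.range e}) ⊕
      {J : {J : Fin d → Fin n // IsBasicTuple ε J} // ¬ ∀ s, J.1 s ∈ Set.range e} → ℂ :=
    Sum.elim (fun p => B p.1 p.2) (fun J => t J.1.1) with hy
  set K := IntermediateField.adjoin ℚ (Set.range y) with hK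
  have hyK : ∀ b, y b ∈ K := fun b => IntermediateField.subset_adjoin _ _ ⟨b, rfl⟩
  have hBK : ∀ i j, B i j ∈ K := by
    intro i j
    by_cases hj : j ∈ Set.range e
    · obtain ⟨j', rfl⟩ := hj
      rw [hBe]
      split_ifs
      · exact K.one_mem
      · exact K.zero_mem
    · exact hyK (Sum.inl (i, ⟨j, hj⟩))
  have htK : ∀ I : Fin d → Fin n, (¬ ∀ s, I s ∈ Set.range e) → t I ∈ K := by
    intro I hI
    by_cases h0 : t I = 0
    · rw [h0]
      exact K.zero_mem
    · obtain ⟨σ, hσ⟩ := exists_basic_of_apply_ne_zero ht h0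
      rw [apply_eq_permChar_mul ht σ]
      refine K.mul_mem (permChar_mem ε σ K) (hyK (Sum.inr ⟨⟨I ∘ σ, hσ⟩, fun h => hI fun s => ?_⟩))
      have := h (σ.symm s)
      simpa using this
  have hxK : ∀ J, x J ∈ K := by
    intro J
    rw [← htx J]
    by_cases hJ : ∀ s, J.1 s ∈ Set.range e
    swap
    · exact htK _ hJ
    choose L hL using hJ
    have h1 := congrFun hBt L
    -- In the isotropy equation at `L`, the only term with all indices in the pivot block is `t J`
    -- itself, with coefficient 1. It is therefore a polynomial in the generators.
    rw [pull_apply, ← Finset.add_sum_erase _ _ (Finset.mem_univ J.1)] at h1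
    have h2 : ∏ s, B (L s) (J.1 s) = 1 := by
      refine Finset.prod_eq_one fun s _ => ?_
      rw [← hL, hBe, if_pos rfl]
    rw [h2, one_mul] at h1
    rw [eq_neg_of_add_eq_zero_left h1]
    refine K.neg_mem (K.sum_mem fun I hI => ?_)
    by_cases hIr : ∀ s, I s ∈ Set.range e
    · have h3 : ∏ s, B (L s) (I s) = 0 := by
        obtain ⟨s, hs⟩ := Function.ne_iff.mp (Finset.ne_of_mem_erase hI)
        refine Finset.prod_eq_zero (Finset.mem_univ s) ?_
        obtain ⟨j, hj⟩ := hIr s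
        rw [← hj, hBe, if_neg]
        intro h
        apply hs
        rw [← hj, ← hL s, h]
      rw [h3, zero_mul]
      exact K.zero_mem
    · exact K.mul_mem (K.prod_mem fun s _ => hBK _ _) (htK I hIr)
  have hcard := hx.card_le_of_mem_adjoin y hxK
  have h1 := Fintype.card_subtype_compl (fun J : {J : Fin d → Fin n // IsBasicTuple ε J} =>
    ∀ s, J.1 s ∈ Set.range e)
  have h2 : Fintype.card {J : {J : Fin d → Fin n // IsBasicTuple ε J} //
      ∀ s, J.1 s ∈ Set.range e} = formDim ε d k := by
    rw [← card_isBasicTuple ε d k]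
    symm
    refine Fintype.card_congr (Equiv.ofBijective (fun L =>
      ⟨⟨e ∘ L.1, (isBasicTuple_comp_iff hmono).mpr L.2⟩, fun s => ⟨L.1 s, rfl⟩⟩) ⟨?_, ?_⟩)
    · intro L L' hLL
      have h3 : e ∘ L.1 = e ∘ L'.1 := congrArg (fun J => J.1.1) hLL
      exact Subtype.ext (e.injective.comp_left h3)
    · rintro ⟨⟨J, hJ⟩, hJe⟩
      have hJe' := hJe
      choose L hL using hJe'
      have h3 : e ∘ L = J := funext hL
      refine ⟨⟨L, (isBasicTuple_comp_iff hmono).mp (by rw [h3]; exact hJ)⟩, ?_⟩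
      exact Subtype.ext (Subtype.ext h3)
  have h3 : Fintype.card {J : {J : Fin d → Fin n // IsBasicTuple ε J} //
      ∀ s, J.1 s ∈ Set.range e} ≤ Fintype.card {J : Fin d → Fin n // IsBasicTuple ε J} :=
    Fintype.card_subtype_le _
  have h4 := card_notMem_range e
  rw [Fintype.card_sum, Fintype.card_prod, Fintype.card_fin] at hcard
  have h5 : Fintype.card {j // j ∉ Set.range e} = n - k := by
    rw [Fintype.card_fin] at h4
    omega
  rw [h5] at hcard
  omega

/-- There are `m` arrays with `d` indices in `Fin k` such that no nonzero symmetric or (if `ε` is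
true) skew-symmetric array with `d + 1` indices has zero contractions with all of them. -/
def HasSeparatingArrays (ε : Bool) (d k m : ℕ) : Prop :=
  ∃ f : Fin m → (Fin d → Fin k) → ℂ, ∀ g ∈ symArray ε (d + 1) (Fin k),
    (∀ i j, ∑ I, g (Fin.cons i I) * f j I = 0) → g = 0

/-- Separating arrays exist if, for every `r`, they may be expected to exist for the arrays `g` whose
first contraction has rank `r`. -/
theorem hasSeparatingArrays_of_forall_rank (ε : Bool) (d k m : ℕ)
    (h : ∀ r, 1 ≤ r → r ≤ k → (ε = true → d + 1 ≤ r) →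
      r * (k - r) + formDim ε (d + 1) r ≤ r * m) : HasSeparatingArrays ε d k m := by
  classical
  obtain ⟨x, hx⟩ := exists_algebraicIndependent_rat (Fin m × (Fin d → Fin k))
  refine ⟨fun j I => x (j, I), fun g hg hgf => ?_⟩
  by_contra hg0
  set G : Fin k → (Fin d → Fin k) → ℂ := fun i I => g (Fin.cons i I) with hG
  obtain ⟨r, e, c, hespan, hc⟩ : ∃ r, ∃ e : Fin r ↪ Fin k, ∃ c : Fin r ↪ (Fin d → Fin k),
      Submodule.span ℂ (Set.range (G ∘ e)) = Submodule.span ℂ (Set.range G) ∧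
        (Matrix.of fun i l => G (e i) (c l)).det ≠ 0 := by
    obtain ⟨e, heli, hespan⟩ := exists_embedding_linearIndependent G
    obtain ⟨c, hc⟩ := exists_embedding_det_ne_zero heli
    exact ⟨_, e, c, hespan, hc⟩
  have hA : ∀ i, ∃ a : Fin r → ℂ,
      (∑ s, a s • G (e s) = G i) ∧ ∀ s, i = e s → a = Pi.single s 1 := by
    intro i
    by_cases hi : ∃ s, i = e s
    · obtain ⟨s, rfl⟩ := hi
      refine ⟨Pi.single s 1, ?_, fun s' hs' => by rw [e.injective hs']⟩
      rw [Finset.sum_eq_single s]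
      · simp
      · intro s' _ hs'
        simp [hs']
      · simp
    · have h1 : G i ∈ Submodule.span ℂ (Set.range (G ∘ e)) := by
        rw [hespan]
        exact Submodule.subset_span ⟨i, rfl⟩
      obtain ⟨a, ha⟩ := (Submodule.mem_span_range_iff_exists_fun ℂ).mp h1
      exact ⟨a, ha, fun s hs => (hi ⟨s, hs⟩).elim⟩
  choose A hAG hAe using hA
  -- Modulo the radical, each basis vector is a combination of the `r` vectors indexed by `e`. Thus
  -- `g` is the pullback under `A` of its restriction `H` to `r` variables.
  set H : (Fin (d + 1) → Fin r) → ℂ := fun J => g (e ∘ J) with hH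
  have hHmem : H ∈ symArray ε (d + 1) (Fin r) := fun σ J => hg σ (e ∘ J)
  have hgH : pull A H = g := by
    have h1 : H = pull (fun s => Pi.single (e s) (1 : ℂ)) g := by
      ext J
      rw [pull_eq_arrayForm]
      exact (arrayForm_single g (e ∘ J)).symm
    rw [h1, pull_pull]
    ext I
    rw [pull_eq_arrayForm, ← arrayForm_single g I]
    refine arrayForm_congr_mod_radical hg fun s L => ?_
    have h2 := congrFun (hAG (I s)) L
    simp only [Finset.sum_apply, Pi.smul_apply, smul_eq_mul, hG] at h2
    simp only [sub_mul, Finset.sum_sub_distrib, Finset.sum_mul]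
    rw [Finset.sum_comm]
    simp [Pi.single_apply, h2]
  have hH0 : ∃ I, H I ≠ 0 := by
    by_contra! hcon
    have : H = 0 := funext hcon
    rw [this, map_zero] at hgH
    exact hg0 hgH.symm
  obtain ⟨I₀, hI₀⟩ := hH0
  obtain ⟨σ₀, hσ₀⟩ := exists_basic_of_apply_ne_zero hHmem hI₀
  set J₀ : {J : Fin (d + 1) → Fin r // IsBasicTuple ε J} := ⟨I₀ ∘ σ₀, hσ₀⟩ with hJ₀
  set a := H J₀.1 with ha
  have ha0 : a ≠ 0 := by
    intro h0
    apply hI₀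
    rw [apply_eq_permChar_mul hHmem σ₀]
    change _ * a = 0
    rw [h0, mul_zero]
  -- Dividing `g` by its nonzero value `a` saves one parameter, which is why the numerical
  -- hypothesis need not be strict.
  set y : ({i // i ∉ Set.range e} × Fin r) ⊕
      {J : {J : Fin (d + 1) → Fin r // IsBasicTuple ε J} // J ≠ J₀} ⊕
      (Fin m × {I // I ∉ Set.range c}) → ℂ := Sum.elim (fun p => A p.1 p.2)
    (Sum.elim (fun J => a⁻¹ * H J.1.1) fun p => x (p.1, p.2)) with hy
  set K := IntermediateField.adjoin ℚ (Set.range y) with hK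
  have hyK : ∀ b, y b ∈ K := fun b => IntermediateField.subset_adjoin _ _ ⟨b, rfl⟩
  have hAK : ∀ i s, A i s ∈ K := by
    intro i s
    by_cases hi : i ∈ Set.range e
    · obtain ⟨s', rfl⟩ := hi
      rw [hAe _ s' rfl, Pi.single_apply]
      split_ifs
      · exact K.one_mem
      · exact K.zero_mem
    · exact hyK (Sum.inl (⟨i, hi⟩, s))
  have hHK : ∀ J, a⁻¹ * H J ∈ K := by
    intro J
    by_cases h0 : H J = 0
    · rw [h0, mul_zero]
      exact K.zero_mem
    · obtain ⟨σ, hσ⟩ := exists_basic_of_apply_ne_zero hHmem h0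
      rw [apply_eq_permChar_mul hHmem σ, mul_left_comm]
      refine K.mul_mem (permChar_mem ε σ K) ?_
      by_cases hJ : (⟨J ∘ σ, hσ⟩ : {J : Fin (d + 1) → Fin r // IsBasicTuple ε J}) = J₀
      · have h1 : J ∘ σ = J₀.1 := congrArg Subtype.val hJ
        rw [h1, ← ha, inv_mul_cancel₀ ha0]
        exact K.one_mem
      · exact hyK (Sum.inr (Sum.inl ⟨⟨J ∘ σ, hσ⟩, hJ⟩))
  have hgK : ∀ I, a⁻¹ * g I ∈ K := by
    intro I
    rw [← hgH, pull_apply, Finset.mul_sum]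
    refine K.sum_mem fun J _ => ?_
    rw [mul_left_comm]
    exact K.mul_mem (K.prod_mem fun s _ => hAK _ _) (hHK J)
  have hxK : ∀ p, x p ∈ K := by
    rintro ⟨j, I⟩
    by_cases hI : I ∈ Set.range c
    swap
    · exact hyK (Sum.inr (Sum.inr (j, ⟨I, hI⟩)))
    obtain ⟨l, rfl⟩ := hI
    -- The `r` equations indexed by `e` form a nonsingular system for the `r` entries of the array
    -- `j` at the positions `c`; all other data lie in `K`.
    refine K.mem_of_mulVec_mem (M := a⁻¹ • Matrix.of fun i l => G (e i) (c l))
      (v := fun l => x (j, c l)) (fun i l => hgK _) ?_ (fun i => ?_) l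
    · rw [Matrix.det_smul]
      exact mul_ne_zero (pow_ne_zero _ (inv_ne_zero ha0)) hc
    · have h1 := hgf (e i) j
      rw [← Finset.sum_add_sum_compl (Finset.univ.map c), Finset.sum_map] at h1
      have h2 : (Matrix.mulVec (a⁻¹ • Matrix.of fun i l => G (e i) (c l))
          (fun l => x (j, c l))) i = a⁻¹ * ∑ l, g (Fin.cons (e i) (c l)) * x (j, c l) := by
        simp [Matrix.mulVec, dotProduct, Finset.mul_sum, hG, mul_assoc]
      rw [h2, eq_neg_of_add_eq_zero_left h1, mul_neg, Finset.mul_sum]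
      refine K.neg_mem (K.sum_mem fun I hI => ?_)
      rw [← mul_assoc]
      refine K.mul_mem (hgK _) (hyK (Sum.inr (Sum.inr (j, ⟨I, ?_⟩))))
      simpa using hI
  have hcard := hx.card_le_of_mem_adjoin y hxK
  have h1 := card_notMem_range e
  have h2 := card_notMem_range c
  have h3 : Fintype.card {J : {J : Fin (d + 1) → Fin r // IsBasicTuple ε J} // J ≠ J₀} + 1 =
      formDim ε (d + 1) r := by
    rw [← card_isBasicTuple ε (d + 1) r]
    have h4 := Fintype.card_subtype_compl (fun J => J = J₀)
    rw [Fintype.card_subtype_eq] at h4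
    have h5 : 0 < Fintype.card {J : Fin (d + 1) → Fin r // IsBasicTuple ε J} :=
      Fintype.card_pos_iff.mpr ⟨J₀⟩
    have h6 : Fintype.card {J : {J : Fin (d + 1) → Fin r // IsBasicTuple ε J} // J ≠ J₀} =
      Fintype.card {J : Fin (d + 1) → Fin r // IsBasicTuple ε J} - 1 := by
      rw [← h4]
    omega
  rw [Fintype.card_sum, Fintype.card_sum, Fintype.card_prod, Fintype.card_prod,
    Fintype.card_prod, Fintype.card_fin, Fintype.card_fin] at hcard
  rw [Fintype.card_fin] at h1
  have hr1 : 1 ≤ r := by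
    have := (I₀ 0).isLt
    omega
  have hrk : r ≤ k := by omega
  have hrd : ε = true → d + 1 ≤ r := by
    rintro rfl
    have := Fintype.card_le_of_injective _ (StrictMono.injective hσ₀)
    simpa using this
  have hmain := h r hr1 hrk hrd
  have h7 : Fintype.card {i // i ∉ Set.range e} = k - r := by omega
  rw [h7, ← h2, mul_add, mul_comm (k - r) r, mul_comm m r] at hcard
  omega

/-! ### Sufficiency of separating arrays, by openness. -/

section symmetrize

variable {d : ℕ} {ι κ : Type*}

theorem symmetrize_eq_of_mem {ε : Bool} {t : (Fin d → ι) → ℂ} (ht : t ∈ symArray ε d ι) :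
    symmetrize ε t = (d.factorial : ℂ) • t := by
  ext I
  simp only [symmetrize, ht _ I, ← mul_assoc, permChar_mul_self, one_mul]
  simp [Finset.card_univ, Fintype.card_perm]

theorem sum_mul_symmetrize [Fintype ι] (ε : Bool) (a b : (Fin d → ι) → ℂ) :
    ∑ I, a I * symmetrize ε b I = ∑ I, symmetrize ε a I * b I := by
  simp only [symmetrize, Finset.mul_sum, Finset.sum_mul]
  rw [Finset.sum_comm, Finset.sum_comm (s := (Finset.univ : Finset (Fin d → ι)))]
  rw [← Equiv.sum_comp (Equiv.inv (Equiv.Perm (Fin d)))]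
  refine Finset.sum_congr rfl fun σ _ => ?_
  rw [← Equiv.sum_comp (σ.symm.arrowCongr (Equiv.refl ι))]
  refine Finset.sum_congr rfl fun I _ => ?_
  have h1 : (σ.symm.arrowCongr (Equiv.refl ι)) I = I ∘ σ := by
    ext s
    simp [Equiv.arrowCongr]
  rw [h1, Equiv.inv_apply, permChar_inv]
  have h2 : (I ∘ σ) ∘ (σ⁻¹ : Equiv.Perm (Fin d)) = I := by
    ext s
    simp
  rw [h2]
  ring

theorem pull_symmetrize [Fintype ι] (ε : Bool) (A : κ → ι → ℂ) (c : (Fin d → ι) → ℂ) :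
    pull A (symmetrize ε c) = symmetrize ε (pull A c) := by
  ext J
  simp only [pull_apply, symmetrize, Finset.mul_sum]
  rw [Finset.sum_comm]
  refine Finset.sum_congr rfl fun σ _ => ?_
  rw [← Equiv.sum_comp (σ.symm.arrowCongr (Equiv.refl ι))
    fun I => permChar ε σ * ((∏ s, A ((J ∘ σ) s) (I s)) * c I)]
  refine Finset.sum_congr rfl fun I _ => ?_
  have h1 : (σ.symm.arrowCongr (Equiv.refl ι)) I = I ∘ σ := by
    ext s
    simp [Equiv.arrowCongr]
  have h2 : ∏ s, A ((J ∘ σ) s) ((I ∘ σ) s) = ∏ s, A (J s) (I s) :=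
    Equiv.prod_comp σ fun s => A (J s) (I s)
  rw [h1, h2]
  ring

/-- `symmetrize` as a linear map. -/
noncomputable def symmetrizeLin (ε : Bool) :
    ((Fin d → ι) → ℂ) →ₗ[ℂ] ((Fin d → ι) → ℂ) where
  toFun := symmetrize ε
  map_add' a b := by
    ext I
    simp [symmetrize, mul_add, Finset.sum_add_distrib]
  map_smul' a b := by
    ext I
    simp only [symmetrize, Pi.smul_apply, smul_eq_mul, Finset.mul_sum, RingHom.id_apply]
    exact Finset.sum_congr rfl fun σ _ => by ring

end symmetrize

section sufficiency

variable {ε : Bool} {d k m : ℕ}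

/-- The basis of the graph of a linear map from `ℂ^k` to `ℂ^m`. -/
def graphRows (φ : Fin k → Fin m → ℂ) : Fin k → Fin k ⊕ Fin m → ℂ :=
  fun i => Sum.elim (Pi.single i 1) (φ i)

theorem linearIndependent_graphRows (φ : Fin k → Fin m → ℂ) :
    LinearIndependent ℂ (graphRows φ) := by
  rw [Fintype.linearIndependent_iff]
  intro g hg i
  have := congrFun hg (Sum.inl i)
  simpa [graphRows, Pi.single_apply] using this

/-- Contraction of the arrays `f j` with a linear map from `ℂ^k` to `ℂ^m`. -/
noncomputable def contractRows (f : Fin m → (Fin d → Fin k) → ℂ) :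
    (Fin k → Fin m → ℂ) →ₗ[ℂ] ((Fin (d + 1) → Fin k) → ℂ) where
  toFun φ := fun J => ∑ j, φ (J 0) j * f j (Fin.tail J)
  map_add' φ ψ := by
    ext J
    simp [add_mul, Finset.sum_add_distrib]
  map_smul' c φ := by
    ext J
    simp [Finset.mul_sum, mul_assoc]

/-- The array of a form on `ℂ^k ⊕ ℂ^m` with first index in `Fin m` and the other indices in
`Fin k`. -/
noncomputable def extendRows (f : Fin m → (Fin d → Fin k) → ℂ) :
    (Fin (d + 1) → Fin k ⊕ Fin m) → ℂ :=
  ∑ j, ∑ I, f j I • Pi.single (Fin.cons (Sum.inr j) fun s => Sum.inl (I s)) 1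

theorem pull_pi_single {ι κ : Type*} [Fintype ι] [DecidableEq ι] (A : κ → ι → ℂ) (I : Fin d → ι)
    (J : Fin d → κ) : pull A (Pi.single I (1 : ℂ)) J = ∏ s, A (J s) (I s) := by
  rw [pull_apply, Finset.sum_eq_single I]
  · simp
  · intro L _ hL
    simp [hL]
  · simp

theorem pull_graphRows_extendRows (f : Fin m → (Fin d → Fin k) → ℂ) (φ : Fin k → Fin m → ℂ) :
    pull (graphRows φ) (extendRows f) = contractRows f φ := by
  ext J
  simp only [extendRows, map_sum, map_smul, Finset.sum_apply, Pi.smul_apply, pull_pi_single,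
    Fin.prod_univ_succ, Fin.cons_zero, Fin.cons_succ, graphRows, Sum.elim_inl, Sum.elim_inr,
    contractRows, LinearMap.coe_mk, AddHom.coe_mk, smul_eq_mul]
  refine Finset.sum_congr rfl fun j _ => ?_
  rw [Finset.sum_eq_single (Fin.tail J)]
  · rw [Finset.prod_eq_one, mul_one, mul_comm]
    intro s _
    simp [Fin.tail]
  · intro I _ hI
    obtain ⟨s, hs⟩ := Function.ne_iff.mp hI
    rw [Finset.prod_eq_zero (Finset.mem_univ s), mul_zero, mul_zero]
    exact Pi.single_eq_of_ne hs 1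
  · simp

/-- By duality: a functional vanishing on the range but not at `w` has a coefficient array whose
symmetrization is annihilated by every `f j`, hence is zero. But symmetrization is self-adjoint and
multiplies `w` by `(d + 1)!`. -/
theorem exists_symmetrize_contractRows_eq {f : Fin m → (Fin d → Fin k) → ℂ}
    (hf : ∀ g ∈ symArray ε (d + 1) (Fin k), (∀ i j, ∑ I, g (Fin.cons i I) * f j I = 0) → g = 0)
    {w : (Fin (d + 1) → Fin k) → ℂ} (hw : w ∈ symArray ε (d + 1) (Fin k)) :
    ∃ φ, symmetrize ε (contractRows f φ) = w := by
  classical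
  by_contra hcon
  set R := LinearMap.range (symmetrizeLin ε ∘ₗ contractRows f) with hR
  have hwR : w ∉ R := by
    rintro ⟨φ, hφ⟩
    exact hcon ⟨φ, hφ⟩
  obtain ⟨l, hlw, hl⟩ := Submodule.exists_le_ker_of_notMem hwR
  set G : (Fin (d + 1) → Fin k) → ℂ := fun J => l (Pi.single J 1) with hG
  have hlG : ∀ x, l x = ∑ J, G J * x J := by
    intro x
    conv_lhs => rw [LinearMap.pi_apply_eq_sum_univ l x]
    refine Finset.sum_congr rfl fun J _ => ?_
    rw [smul_eq_mul, mul_comm]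
    congr 2
    ext I
    rw [Pi.single_apply]
    simp only [eq_comm]
  have hg0 : symmetrize ε G = 0 := by
    refine hf _ (symmetrize_mem ε G) fun i j => ?_
    have h1 : l (symmetrize ε (contractRows f (Pi.single i (Pi.single j 1)))) = 0 :=
      hl ⟨Pi.single i (Pi.single j 1), rfl⟩
    rw [hlG, sum_mul_symmetrize, ← Equiv.sum_comp (Fin.consEquiv fun _ => Fin k),
      Fintype.sum_prod_type, Finset.sum_eq_single i] at h1
    · rw [← h1]
      refine Finset.sum_congr rfl fun I _ => ?_
      simp [Fin.consEquiv, contractRows, Pi.single_apply]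
    · intro i' _ hi'
      refine Finset.sum_eq_zero fun I _ => ?_
      simp [Fin.consEquiv, contractRows, hi']
    · simp
  have h2 : l (symmetrize ε w) = 0 := by
    rw [hlG, sum_mul_symmetrize, hg0]
    simp
  rw [symmetrize_eq_of_mem hw, map_smul, smul_eq_mul] at h2
  exact hlw ((mul_eq_zero.mp h2).resolve_left (by exact_mod_cast (Nat.factorial_pos _).ne'))

open Topology in
/-- If separating arrays exist, all forms near a suitable one have isotropic subspaces. -/
theorem exists_eventually_hasIsotropicRows (h : HasSeparatingArrays ε d k m) :
    ∃ t₀ : symArray ε (d + 1) (Fin k ⊕ Fin m), ∀ᶠ t : symArray ε (d + 1) (Fin k ⊕ Fin m) in 𝓝 t₀,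
      HasIsotropicRows (t : (Fin (d + 1) → Fin k ⊕ Fin m) → ℂ) k := by
  obtain ⟨f, hf⟩ := h
  set T := symArray ε (d + 1) (Fin k ⊕ Fin m) with hT
  set S := symArray ε (d + 1) (Fin k) with hS
  set t₀ : T := ⟨symmetrize ε (extendRows f), symmetrize_mem _ _⟩ with ht₀
  obtain ⟨q, hq⟩ := LinearMap.exists_leftInverse_of_injective S.subtype S.ker_subtype
  have hqS : ∀ x (hx : x ∈ S), q x = ⟨x, hx⟩ := fun x hx => LinearMap.congr_fun hq ⟨x, hx⟩
  set P : (Fin k → Fin m → ℂ) × T → ((Fin (d + 1) → Fin k) → ℂ) := fun p =>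
    pull (graphRows p.1) (p.2 : (Fin (d + 1) → Fin k ⊕ Fin m) → ℂ) with hP
  have hPS : ∀ p, P p ∈ S := fun p => pull_mem _ p.2.2
  set G : (Fin k → Fin m → ℂ) × T → S := fun p => q.toContinuousLinearMap (P p) with hG
  have hGP : ∀ p, G p = ⟨P p, hPS p⟩ := fun p => hqS _ _
  have hPt₀ : ∀ φ, P (φ, t₀) = symmetrize ε (contractRows f φ) := by
    intro φ
    simp only [hP, ht₀]
    rw [pull_symmetrize, pull_graphRows_extendRows]
  have hsmooth : ContDiff ℂ 1 P := by
    rw [contDiff_pi]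
    intro J
    simp only [hP, pull_apply]
    refine ContDiff.sum fun I _ => ContDiff.mul (contDiff_prod fun s _ => ?_) ?_
    · rcases hI : I s with i | j
      · simp only [graphRows, Sum.elim_inl]
        exact contDiff_const
      · simp only [graphRows, Sum.elim_inr]
        exact (contDiff_apply_apply ℂ ℂ (J s) j).comp contDiff_fst
    · have h1 : ContDiff ℂ 1 fun t : T => (t : (Fin (d + 1) → Fin k ⊕ Fin m) → ℂ) I :=
        ((LinearMap.proj I ∘ₗ T.subtype).toContinuousLinearMap).contDiff
      exact h1.comp contDiff_snd
  have hGsmooth : ContDiff ℂ 1 G := q.toContinuousLinearMap.contDiff.comp hsmooth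
  have hD : HasStrictFDerivAt G (fderiv ℂ G (0, t₀)) (0, t₀) :=
    hGsmooth.contDiffAt.hasStrictFDerivAt one_ne_zero
  set D := fderiv ℂ G (0, t₀) with hDdef
  -- Since `t₀` comes from an array with exactly one index in `Fin m`, `G (φ, t₀)` is linear in `φ`
  -- and so equals its own derivative.
  have hDφ : ∀ φ, D (φ, 0) = G (φ, t₀) := by
    intro φ
    have h1 : HasDerivAt (fun s : ℂ => ((0, t₀) : (Fin k → Fin m → ℂ) × T) + s • (φ, (0 : T)))
        (φ, (0 : T)) 0 := by
      simpa using ((hasDerivAt_id (0 : ℂ)).smul_const (φ, (0 : T))).const_add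
        ((0, t₀) : (Fin k → Fin m → ℂ) × T)
    have h0 : ((0, t₀) : (Fin k → Fin m → ℂ) × T) + (0 : ℂ) • (φ, (0 : T)) = (0, t₀) := by simp
    have h2 : HasDerivAt (fun s : ℂ => G (((0, t₀) : (Fin k → Fin m → ℂ) × T) + s • (φ, (0 : T))))
        (D (φ, 0)) 0 :=
      HasFDerivAt.comp_hasDerivAt (l := G) (l' := D) 0 (by rw [h0]; exact hD.hasFDerivAt) h1
    have h3 : (fun s : ℂ => G (((0, t₀) : (Fin k → Fin m → ℂ) × T) + s • (φ, (0 : T)))) =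
        fun s : ℂ => s • G (φ, t₀) := by
      ext1 s
      have h4 : ((0, t₀) : (Fin k → Fin m → ℂ) × T) + s • (φ, (0 : T)) = (s • φ, t₀) := by
        simp
      rw [h4, hGP, hGP]
      apply Subtype.ext
      simp only [Submodule.coe_smul]
      rw [hPt₀, hPt₀, map_smul]
      exact map_smul (symmetrizeLin ε) s _
    rw [h3] at h2
    have h5 : HasDerivAt (fun s : ℂ => s • G (φ, t₀)) (G (φ, t₀)) 0 := by
      simpa using (hasDerivAt_id (0 : ℂ)).smul_const (G (φ, t₀))
    exact h2.unique h5
  -- Adjoining the form itself to the values makes the derivative onto. The image then contains `(0,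
  -- t)` for every `t` near `t₀`, that is, an isotropic graph for `t`.
  have hstrict : HasStrictFDerivAt (fun p => (G p, p.2))
      (D.prod (ContinuousLinearMap.snd ℂ (Fin k → Fin m → ℂ) T)) (0, t₀) :=
    hD.prodMk hasStrictFDerivAt_snd
  have hsurj : LinearMap.range
      (D.prod (ContinuousLinearMap.snd ℂ (Fin k → Fin m → ℂ) T)).toLinearMap = ⊤ := by
    rw [LinearMap.range_eq_top]
    rintro ⟨r, w⟩
    obtain ⟨φ, hφ⟩ := exists_symmetrize_contractRows_eq hf (r - D (0, w)).2
    refine ⟨(φ, w), ?_⟩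
    have h1 : D (φ, w) = r := by
      have h2 : ((φ, w) : (Fin k → Fin m → ℂ) × T) = (φ, 0) + (0, w) := by simp
      rw [h2, map_add, hDφ, hGP]
      have h3 : (⟨P (φ, t₀), hPS _⟩ : S) = r - D (0, w) :=
        Subtype.ext ((hPt₀ φ).trans hφ)
      rw [h3, sub_add_cancel]
    exact Prod.ext h1 rfl
  have hopen := hstrict.map_nhds_eq_of_surj hsurj
  have hG0 : G (0, t₀) = 0 := by
    rw [← hDφ 0]
    exact map_zero D
  rw [hG0] at hopen
  have hrange : Set.range (fun p => (G p, p.2)) ∈ 𝓝 ((0 : S), t₀) := by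
    rw [← hopen]
    exact Filter.range_mem_map
  refine ⟨t₀, ?_⟩
  have hcont : Filter.Tendsto (fun t : T => ((0 : S), t)) (𝓝 t₀) (𝓝 ((0 : S), t₀)) :=
    (Continuous.prodMk_right (0 : S)).tendsto t₀
  filter_upwards [hcont hrange] with t ht
  obtain ⟨⟨φ, t'⟩, hp⟩ := ht
  obtain rfl : t' = t := congrArg Prod.snd hp
  have h1 : G (φ, t') = 0 := congrArg Prod.fst hp
  rw [hGP] at h1
  exact ⟨graphRows φ, linearIndependent_graphRows φ, congrArg Subtype.val h1⟩

/-- If separating arrays exist, all forms have isotropic subspaces. -/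
theorem HasSeparatingArrays.hasIsotropicRows (h : HasSeparatingArrays ε d k m)
    (t : symArray ε (d + 1) (Fin k ⊕ Fin m)) :
    HasIsotropicRows (t : (Fin (d + 1) → Fin k ⊕ Fin m) → ℂ) k := by
  rcases forall_hasIsotropicRows_or_generically_not (d := d + 1) (ι := Fin k ⊕ Fin m) ε k with
    hall | hgen
  · exact hall t
  · exfalso
    obtain ⟨t₀, ht₀⟩ := exists_eventually_hasIsotropicRows h
    set O := interior {t : symArray ε (d + 1) (Fin k ⊕ Fin m) |
      HasIsotropicRows (t : (Fin (d + 1) → Fin k ⊕ Fin m) → ℂ) k}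
    -- A generic property is dense, so it cannot avoid the nonempty open set `O`.
    have h1 : HoldsGenerically fun t => t ∉ O := by
      refine hgen.mono fun t ht ht' => ht ?_
      have h2 : t ∈ {t : symArray ε (d + 1) (Fin k ⊕ Fin m) |
        HasIsotropicRows (t : (Fin (d + 1) → Fin k ⊕ Fin m) → ℂ) k} := interior_subset ht'
      exact h2
    exact h1.forall_of_isClosed isOpen_interior.isClosed_compl t₀
      (mem_interior_iff_mem_nhds.mpr ht₀)

end sufficiency

/-! ### Passage between forms on `V` and coordinate arrays. -/

section bridge

variable {d : ℕ} {V ι : Type*} [AddCommGroup V] [Module ℂ V] [Fintype ι]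

/-- The coordinate array of a multilinear form in a basis. -/
noncomputable def coordArray (b : Module.Basis ι ℂ V)
    (w : MultilinearMap ℂ (fun _ : Fin d => V) ℂ) :
    (Fin d → ι) → ℂ := fun I => w fun s => b (I s)

theorem apply_eq_sum_coordArray (b : Module.Basis ι ℂ V)
    (w : MultilinearMap ℂ (fun _ : Fin d => V) ℂ) (v : Fin d → V) :
    w v = ∑ I : Fin d → ι, (∏ s, b.equivFun (v s) (I s)) * coordArray b w I := by
  have h : v = fun s => ∑ i, b.equivFun (v s) i • b i := by
    ext s
    exact (b.sum_equivFun (v s)).symm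
  conv_lhs => rw [h]
  rw [MultilinearMap.map_sum]
  refine Finset.sum_congr rfl fun I _ => ?_
  rw [MultilinearMap.map_smul_univ]
  rfl

theorem pull_coordArray {κ : Type*} (b : Module.Basis ι ℂ V)
    (w : MultilinearMap ℂ (fun _ : Fin d => V) ℂ) (v : κ → V) (J : Fin d → κ) :
    pull (fun i => b.equivFun (v i)) (coordArray b w) J = w fun s => v (J s) := by
  rw [apply_eq_sum_coordArray b, pull_apply]

theorem hasIsotropicSubspace_iff (b : Module.Basis ι ℂ V)
    (w : MultilinearMap ℂ (fun _ : Fin d => V) ℂ) (k : ℕ) :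
    HasIsotropicSubspace w k ↔ HasIsotropicRows (coordArray b w) k := by
  have : FiniteDimensional ℂ V := Module.Basis.finiteDimensional_of_finite b
  constructor
  · rintro ⟨U, hU, hw⟩
    set c := Module.finBasisOfFinrankEq ℂ U hU
    refine ⟨fun i => b.equivFun (c i : V), ?_, ?_⟩
    · exact (c.linearIndependent.map' U.subtype U.ker_subtype).map' b.equivFun.toLinearMap
        b.equivFun.ker
    · ext J
      rw [pull_coordArray b w (fun i => (c i : V))]
      exact hw _ fun s => (c (J s)).2
  · rintro ⟨A, hA, h0⟩
    set u : Fin k → V := fun i => b.equivFun.symm (A i) with hu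
    have hui : LinearIndependent ℂ u := hA.map' b.equivFun.symm.toLinearMap b.equivFun.symm.ker
    refine ⟨Submodule.span ℂ (Set.range u), ?_, fun v hv => ?_⟩
    · rw [finrank_span_eq_card hui, Fintype.card_fin]
    · have h1 : pull (fun s => b.equivFun (v s)) (coordArray b w) = 0 := by
        refine pull_eq_zero_of_mem_span h0 fun s => ?_
        have h2 := Submodule.mem_map_of_mem (f := b.equivFun.toLinearMap) (hv s)
        rw [Submodule.map_span, ← Set.range_comp] at h2
        have h3 : (⇑b.equivFun.toLinearMap ∘ u) = A := by
          ext1 i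
          simp only [Function.comp_apply, hu, LinearEquiv.coe_coe, LinearEquiv.apply_symm_apply]
        rw [h3] at h2
        exact h2
      have h2 := congrFun h1 id
      rw [pull_coordArray b w v] at h2
      exact h2

theorem arrayForm_perm {ε : Bool} {t : (Fin d → ι) → ℂ} (ht : t ∈ symArray ε d ι)
    (σ : Equiv.Perm (Fin d)) (v : Fin d → ι → ℂ) :
    arrayForm t (fun s => v (σ s)) = permChar ε σ * arrayForm t v := by
  have h := pull_mem v ht σ id
  rwa [pull_eq_arrayForm, pull_eq_arrayForm] at h

theorem coordArray_arrayForm [DecidableEq ι] (b : Module.Basis ι ℂ V) (t : (Fin d → ι) → ℂ) :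
    coordArray b ((arrayForm t).compLinearMap fun _ => b.equivFun.toLinearMap) = t := by
  ext I
  rw [coordArray, MultilinearMap.compLinearMap_apply, ← arrayForm_single t I]
  congr 1
  ext s j
  simp [Pi.single_apply, eq_comm]

/-- The coordinate array of a symmetric form, as a linear map. -/
noncomputable def symFormCoord (b : Module.Basis ι ℂ V) : SymForm d V →ₗ[ℂ] symArray false d ι where
  toFun := fun w => ⟨coordArray b w.1, fun σ I => by
    rw [permChar, if_neg Bool.false_ne_true, one_mul]
    exact w.2 σ fun s => b (I s)⟩
  map_add' := fun _ _ => rfl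
  map_smul' := fun _ _ => rfl

theorem symFormCoord_bijective [DecidableEq ι] (b : Module.Basis ι ℂ V) :
    Function.Bijective (symFormCoord (d := d) b) := by
  constructor
  · intro w w' h
    apply Subtype.ext
    exact Module.Basis.ext_multilinear (fun _ => b) fun I => congrFun (congrArg Subtype.val h) I
  · intro t
    refine ⟨⟨(arrayForm t.1).compLinearMap fun _ => b.equivFun.toLinearMap, fun σ v => ?_⟩,
      Subtype.ext (coordArray_arrayForm b t.1)⟩
    have h := arrayForm_perm t.2 σ fun s => b.equivFun (v s)
    rw [permChar, if_neg Bool.false_ne_true, one_mul] at h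
    exact h

/-- The coordinate array of an alternating form, as a linear map. -/
noncomputable def alternatingCoord (b : Module.Basis ι ℂ V) :
    (V [⋀^Fin d]→ₗ[ℂ] ℂ) →ₗ[ℂ] symArray true d ι where
  toFun := fun w => ⟨coordArray b w.toMultilinearMap, fun σ I => by
    have h := w.map_perm (fun s => b (I s)) σ
    rw [Units.smul_def, zsmul_eq_mul] at h
    rw [permChar, if_pos rfl]
    exact h⟩
  map_add' := fun _ _ => rfl
  map_smul' := fun _ _ => rfl

theorem alternatingCoord_bijective [DecidableEq ι] (b : Module.Basis ι ℂ V) :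
    Function.Bijective (alternatingCoord (d := d) b) := by
  constructor
  · intro w w' h
    apply AlternatingMap.coe_multilinearMap_injective
    exact Module.Basis.ext_multilinear (fun _ => b) fun I => congrFun (congrArg Subtype.val h) I
  · intro t
    refine ⟨{ (arrayForm t.1).compLinearMap fun _ => b.equivFun.toLinearMap with
      map_eq_zero_of_eq' := fun v i j hij hne => ?_ }, Subtype.ext (coordArray_arrayForm b t.1)⟩
    have h := arrayForm_perm t.2 (Equiv.swap i j) fun s => b.equivFun (v s)
    have h2 : (fun s => b.equivFun (v (Equiv.swap i j s))) = fun s => b.equivFun (v s) := by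
      ext1 s
      congr 1
      simp only [Equiv.swap_apply_def]
      split_ifs with h h' <;> simp_all
    rw [h2, permChar, if_pos rfl, Equiv.Perm.sign_swap hne] at h
    push_cast at h
    change arrayForm t.1 (fun s => b.equivFun (v s)) = 0
    linear_combination h / 2

/-- The dichotomy reduces each generic equivalence to a statement about all forms on one side and a
single form on the other. -/
theorem holdsGenerically_hasIsotropicRows_iff {ε : Bool} {k n : ℕ} {c : Prop}
    (hpos : c → ∀ t : symArray ε d (Fin n), HasIsotropicRows (t : (Fin d → Fin n) → ℂ) k)
    (hneg : ¬ c → ∃ t ∈ symArray ε d (Fin n), ¬ HasIsotropicRows t k) :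
    HoldsGenerically fun t : symArray ε d (Fin n) =>
      (HasIsotropicRows (t : (Fin d → Fin n) → ℂ) k ↔ c) := by
  by_cases hc : c
  · exact holdsGenerically_of_forall fun t => ⟨fun _ => hc, fun h => hpos h t⟩
  · rcases forall_hasIsotropicRows_or_generically_not (d := d) (ι := Fin n) ε k with h | h
    · obtain ⟨t, ht, htk⟩ := hneg hc
      exact (htk (h ⟨t, ht⟩)).elim
    · exact h.mono fun t ht => ⟨fun h' => (ht h').elim, fun h' => (hc h').elim⟩

theorem SymForm.holdsGenerically_iff [FiniteDimensional ℂ V] {k n : ℕ} {c : Prop}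
    (hn : Module.finrank ℂ V = n)
    (hpos : c → ∀ t : symArray false d (Fin n), HasIsotropicRows (t : (Fin d → Fin n) → ℂ) k)
    (hneg : ¬ c → ∃ t ∈ symArray false d (Fin n), ¬ HasIsotropicRows t k) :
    HoldsGenerically fun w : SymForm d V =>
      (HasIsotropicSubspace (w : MultilinearMap ℂ (fun _ : Fin d => V) ℂ) k ↔ c) := by
  set b := Module.finBasisOfFinrankEq ℂ V hn
  refine ((holdsGenerically_hasIsotropicRows_iff hpos hneg).comp_linearEquiv
    (LinearEquiv.ofBijective (symFormCoord b) (symFormCoord_bijective b))).mono fun w hw => ?_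
  rw [hasIsotropicSubspace_iff b]
  exact hw

theorem AlternatingMap.holdsGenerically_iff [FiniteDimensional ℂ V] {k n : ℕ} {c : Prop}
    (hn : Module.finrank ℂ V = n)
    (hpos : c → ∀ t : symArray true d (Fin n), HasIsotropicRows (t : (Fin d → Fin n) → ℂ) k)
    (hneg : ¬ c → ∃ t ∈ symArray true d (Fin n), ¬ HasIsotropicRows t k) :
    HoldsGenerically fun w : V [⋀^Fin d]→ₗ[ℂ] ℂ =>
      (HasIsotropicSubspace w.toMultilinearMap k ↔ c) := by
  set b := Module.finBasisOfFinrankEq ℂ V hn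
  refine ((holdsGenerically_hasIsotropicRows_iff hpos hneg).comp_linearEquiv
    (LinearEquiv.ofBijective (alternatingCoord b) (alternatingCoord_bijective b))).mono fun w hw => ?_
  rw [hasIsotropicSubspace_iff b]
  exact hw

theorem HasSeparatingArrays.hasIsotropicRows_fin {ε : Bool} {k n : ℕ} (hk : k ≤ n)
    (h : HasSeparatingArrays ε d k (n - k)) (t : symArray ε (d + 1) (Fin n)) :
    HasIsotropicRows (t : (Fin (d + 1) → Fin n) → ℂ) k := by
  set e : Fin k ⊕ Fin (n - k) ≃ Fin n := finSumFinEquiv.trans (finCongr (by omega))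
  obtain ⟨A, hA, h0⟩ := h.hasIsotropicRows ⟨fun I => t.1 (e ∘ I), fun σ I => t.2 σ (e ∘ I)⟩
  refine ⟨fun i => A i ∘ e.symm, ?_, ?_⟩
  · exact hA.map' (LinearEquiv.funCongrLeft ℂ ℂ e.symm).toLinearMap (LinearEquiv.ker _)
  · ext J
    refine Eq.trans ?_ (congrFun h0 J)
    rw [pull_apply, pull_apply, ← Equiv.sum_comp ((Equiv.refl (Fin (d + 1))).arrowCongr e)]
    refine Finset.sum_congr rfl fun I _ => ?_
    simp [Equiv.arrowCongr]

end bridge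

/-! ### Dimension bounds for isotropic subspaces of bilinear forms. -/

section orthogonality

variable {n : ℕ}

theorem finrank_add_finrank_le_of_dotProduct_eq_zero {U W : Submodule ℂ (Fin n → ℂ)}
    (h : ∀ u ∈ U, ∀ w ∈ W, u ⬝ᵥ w = 0) : Module.finrank ℂ U + Module.finrank ℂ W ≤ n := by
  have h1 := Subspace.finrank_add_finrank_dualAnnihilator_eq W
  rw [Module.finrank_fintype_fun_eq_card, Fintype.card_fin] at h1
  have h2 : U.map (dotProductEquiv ℂ (Fin n)).toLinearMap ≤ W.dualAnnihilator := by
    rintro _ ⟨u, hu, rfl⟩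
    rw [Submodule.mem_dualAnnihilator]
    exact fun w hw => h u hu w hw
  have h3 := Submodule.finrank_mono h2
  rw [LinearEquiv.finrank_map_eq] at h3
  omega

/-- A totally isotropic subspace of the bilinear form `u ⬝ᵥ L v` has dimension at most
`(n + dim (ker L)) / 2`. -/
theorem two_mul_finrank_le_of_isotropic {U : Submodule ℂ (Fin n → ℂ)}
    (L : (Fin n → ℂ) →ₗ[ℂ] (Fin n → ℂ)) (h : ∀ u ∈ U, ∀ v ∈ U, u ⬝ᵥ L v = 0) :
    2 * Module.finrank ℂ U ≤ n + Module.finrank ℂ (LinearMap.ker L) := by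
  have h1 : Module.finrank ℂ U + Module.finrank ℂ (U.map L) ≤ n := by
    refine finrank_add_finrank_le_of_dotProduct_eq_zero fun u hu w hw => ?_
    obtain ⟨v, hv, rfl⟩ := hw
    exact h u hu v hv
  have h2 := (L.domRestrict U).finrank_range_add_finrank_ker
  rw [LinearMap.range_domRestrict] at h2
  have h3 : Module.finrank ℂ (LinearMap.ker (L.domRestrict U)) ≤
      Module.finrank ℂ (LinearMap.ker L) := by
    have h4 : (LinearMap.ker (L.domRestrict U)).map U.subtype ≤ LinearMap.ker L := by
      rintro _ ⟨u, hu, rfl⟩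
      exact hu
    have h5 := Submodule.finrank_mono h4
    rwa [Submodule.finrank_map_subtype_eq] at h5
  omega

theorem exists_isotropic_submodule {d k : ℕ} {t : (Fin d → Fin n) → ℂ}
    (h : HasIsotropicRows t k) : ∃ U : Submodule ℂ (Fin n → ℂ), Module.finrank ℂ U = k ∧
      ∀ v : Fin d → Fin n → ℂ, (∀ s, v s ∈ U) → arrayForm t v = 0 := by
  obtain ⟨A, hA, h0⟩ := h
  refine ⟨Submodule.span ℂ (Set.range A), ?_, fun v hv => ?_⟩
  · rw [finrank_span_eq_card hA, Fintype.card_fin]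
  · have := congrFun (pull_eq_zero_of_mem_span h0 hv) id
    rwa [pull_eq_arrayForm] at this

end orthogonality

/-! ### Degree two: bilinear forms with small kernel. -/

section quadratic

variable {n k : ℕ}

/-- The array of the bilinear form pairing `e_i` and `s i • e_{τ i}`. -/
def pairingArray (s : Fin n → ℂ) (τ : Fin n → Fin n) : (Fin 2 → Fin n) → ℂ :=
  fun I => if I 1 = τ (I 0) then s (I 0) else 0

theorem arrayForm_pairingArray (s : Fin n → ℂ) (τ : Fin n → Fin n) (u v : Fin n → ℂ) :
    arrayForm (pairingArray s τ) ![u, v] = u ⬝ᵥ fun i => s i * v (τ i) := by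
  rw [arrayForm_apply, ← Equiv.sum_comp (finTwoArrowEquiv (Fin n)).symm, Fintype.sum_prod_type]
  simp only [dotProduct]
  refine Finset.sum_congr rfl fun i _ => ?_
  simp [Fin.prod_univ_two, pairingArray, finTwoArrowEquiv]
  ring

theorem two_mul_le_of_hasIsotropicRows_pairingArray {s : Fin n → ℂ} {τ : Fin n → Fin n}
    (h : HasIsotropicRows (pairingArray s τ) k) :
    2 * k ≤ n + Module.finrank ℂ (LinearMap.ker (LinearMap.pi fun i =>
      s i • (LinearMap.proj (τ i) : (Fin n → ℂ) →ₗ[ℂ] ℂ))) := by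
  obtain ⟨U, rfl, hU⟩ := exists_isotropic_submodule h
  refine two_mul_finrank_le_of_isotropic _ fun u hu v hv => ?_
  have h1 := hU ![u, v] fun s => by fin_cases s <;> simpa
  rw [arrayForm_pairingArray] at h1
  exact h1

theorem eq_one_or_eq_swap (σ : Equiv.Perm (Fin 2)) : σ = 1 ∨ σ = Equiv.swap 0 1 := by
  decide +revert

theorem exists_symmetric_not_hasIsotropicRows (h : n < 2 * k) :
    ∃ t ∈ symArray false 2 (Fin n), ¬ HasIsotropicRows t k := by
  refine ⟨pairingArray 1 id, fun σ I => ?_, fun hk => ?_⟩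
  · rw [permChar, if_neg Bool.false_ne_true, one_mul]
    rcases eq_one_or_eq_swap σ with rfl | rfl
    · rfl
    · simp [pairingArray, eq_comm]
  · have h1 := two_mul_le_of_hasIsotropicRows_pairingArray hk
    have h2 : LinearMap.ker (LinearMap.pi fun i =>
        (1 : Fin n → ℂ) i • (LinearMap.proj (id i) : (Fin n → ℂ) →ₗ[ℂ] ℂ)) = ⊥ := by
      rw [LinearMap.ker_eq_bot']
      intro v hv
      ext i
      simpa using congrFun hv i
    rw [h2, finrank_bot] at h1
    omega

/-- The sign of `Fin.rev i - i`. -/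
noncomputable def revSign (i : Fin n) : ℂ :=
  if i < i.rev then 1 else if i.rev < i then -1 else 0

theorem revSign_rev (i : Fin n) : revSign i.rev = - revSign i := by
  simp only [revSign, Fin.rev_rev]
  rcases lt_trichotomy i i.rev with h | h | h
  · simp [h, h.not_gt]
  · simp [← h]
  · simp [h, h.not_gt]

theorem revSign_ne_zero {i : Fin n} (h : i ≠ i.rev) : revSign i ≠ 0 := by
  rcases lt_or_gt_of_ne h with h | h
  · simp [revSign, h]
  · simp [revSign, h, h.not_gt]

theorem pairingArray_revSign_mem : pairingArray revSign Fin.rev ∈ symArray true 2 (Fin n) := by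
  intro σ I
  rw [permChar, if_pos rfl]
  rcases eq_one_or_eq_swap σ with rfl | rfl
  · simp [pairingArray]
    rfl
  · have h : I 0 = (I 1).rev ↔ I 1 = (I 0).rev := by
      rw [eq_comm, Fin.rev_eq_iff]
    simp only [pairingArray, Function.comp_apply]
    have h0 : (Equiv.swap (0 : Fin 2) 1) 0 = 1 := rfl
    have h1 : (Equiv.swap (0 : Fin 2) 1) 1 = 0 := rfl
    change (if I 0 = (I 1).rev then revSign (I 1) else 0) =
      ((Equiv.Perm.sign (Equiv.swap (0 : Fin 2) 1) : ℤ) : ℂ) * _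
    rw [Equiv.Perm.sign_swap (by decide)]
    by_cases hI : I 1 = (I 0).rev
    · rw [if_pos (h.mpr hI), if_pos hI, hI, revSign_rev]
      simp
    · rw [if_neg (fun h' => hI (h.mp h')), if_neg hI, mul_zero]

/-- Pairing each index with its reverse gives zero kernel for even `n`; for odd `n` the kernel lies
on the line of the middle basis vector. -/
theorem exists_alternating_not_hasIsotropicRows
    (h : n + (if Even n then 0 else 1) < 2 * k) :
    ∃ t ∈ symArray true 2 (Fin n), ¬ HasIsotropicRows t k := by
  refine ⟨pairingArray revSign Fin.rev, pairingArray_revSign_mem, fun hk => ?_⟩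
  have h1 := two_mul_le_of_hasIsotropicRows_pairingArray hk
  set K := LinearMap.ker (LinearMap.pi fun i =>
    revSign i • (LinearMap.proj (Fin.rev i) : (Fin n → ℂ) →ₗ[ℂ] ℂ)) with hK
  have hv : ∀ v ∈ K, ∀ i : Fin n, i ≠ i.rev → v i = 0 := by
    intro v hv i hi
    have h2 := congrFun (LinearMap.mem_ker.mp hv) i.rev
    simp only [LinearMap.pi_apply, LinearMap.smul_apply, LinearMap.proj_apply, Fin.rev_rev,
      smul_eq_mul, Pi.zero_apply] at h2
    exact (mul_eq_zero.mp h2).resolve_left (revSign_ne_zero (by rw [Fin.rev_rev]; exact hi.symm))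
  by_cases hn : Even n
  · rw [if_pos hn] at h
    have h2 : K = ⊥ := by
      rw [Submodule.eq_bot_iff]
      intro v hvK
      ext i
      refine hv v hvK i fun hi => ?_
      have := congrArg Fin.val hi
      rw [Fin.val_rev] at this
      obtain ⟨p, hp⟩ := hn
      omega
    rw [h2, finrank_bot] at h1
    omega
  · rw [if_neg hn] at h
    have hn0 : n / 2 < n := by
      have : n ≠ 0 := by
        rintro rfl
        exact hn Even.zero
      omega
    have h2 : K ≤ Submodule.span ℂ {Pi.single ⟨n / 2, hn0⟩ 1} := by
      intro v hvK
      rw [Submodule.mem_span_singleton]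
      refine ⟨v ⟨n / 2, hn0⟩, ?_⟩
      ext i
      by_cases hi : i = ⟨n / 2, hn0⟩
      · rw [hi]
        simp
      · rw [Pi.smul_apply, Pi.single_eq_of_ne hi, smul_zero, hv v hvK i]
        intro hi'
        apply hi
        have := congrArg Fin.val hi'
        rw [Fin.val_rev] at this
        ext
        simp only
        omega
    have h3 := (Submodule.finrank_mono h2).trans
      ((finrank_span_le_card _).trans_eq (Set.toFinset_card _))
    rw [Fintype.card_unique] at h3
    omega

end quadratic

/-! ### Degree `n - 2` and the pairing of indices. -/

section corankTwo

variable {n : ℕ}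

theorem fin_ne_rev (hn : Even n) (i : Fin n) : i ≠ i.rev := by
  intro h
  have := congrArg Fin.val h
  rw [Fin.val_rev] at this
  obtain ⟨p, hp⟩ := hn
  omega

/-- The increasing enumeration of all indices other than `c` and `Fin.rev c`. -/
noncomputable def complPair (hn : Even n) {d : ℕ} (hd : d + 2 = n) (c : Fin n) : Fin d ↪o Fin n :=
  ({c, c.rev}ᶜ : Finset (Fin n)).orderEmbOfFin (by
    rw [Finset.card_compl, Finset.card_pair (fin_ne_rev hn c), Fintype.card_fin]
    omega)

theorem range_complPair (hn : Even n) {d : ℕ} (hd : d + 2 = n) (c : Fin n) :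
    Set.range (complPair hn hd c) = {c, c.rev}ᶜ := by
  rw [complPair, Finset.range_orderEmbOfFin]
  push_cast
  rfl

/-- For even `n` a generic form of degree `n - 2` has no isotropic hyperplane. -/
theorem exists_not_hasIsotropicRows_corank_two (hn : Even n) {d : ℕ} (hd : d + 2 = n) :
    ∃ t ∈ symArray true d (Fin n), ¬ HasIsotropicRows t (d + 1) := by
  classical
  obtain ⟨t, ht, htx⟩ := exists_mem_symArray_of_values (ι := Fin n) (d := d) true
    fun J => if ∃ i, Set.range J.1 = {i, i.rev}ᶜ then 1 else 0
  refine ⟨t, ht, fun hk => ?_⟩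
  have htr : ∀ I, t I ≠ 0 → ∃ i, Set.range I = {i, i.rev}ᶜ := by
    intro I hI
    obtain ⟨σ, hσ⟩ := exists_basic_of_apply_ne_zero ht hI
    rw [apply_eq_permChar_mul ht σ, htx ⟨_, hσ⟩] at hI
    have h1 := ite_ne_right_iff.mp (right_ne_zero_of_mul hI)
    obtain ⟨i, hi⟩ := h1.1
    refine ⟨i, ?_⟩
    rw [← hi]
    exact (σ.surjective.range_comp I).symm
  obtain ⟨U, hU, hiso⟩ := exists_isotropic_submodule hk
  obtain ⟨c, hc⟩ : ∃ c : Fin n, Pi.single c (1 : ℂ) ∉ U := by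
    by_contra! hall
    have h1 : U = ⊤ := by
      rw [eq_top_iff, ← (Pi.basisFun ℂ (Fin n)).span_eq, Submodule.span_le]
      rintro _ ⟨i, rfl⟩
      rw [Pi.basisFun_apply]
      exact hall i
    rw [h1, finrank_top, Module.finrank_fintype_fun_eq_card, Fintype.card_fin] at hU
    omega
  have hsup : U ⊔ Submodule.span ℂ {Pi.single c (1 : ℂ)} = ⊤ := by
    apply Submodule.eq_top_of_finrank_eq
    rw [Module.finrank_fintype_fun_eq_card, Fintype.card_fin]
    have h1 : U < U ⊔ Submodule.span ℂ {Pi.single c (1 : ℂ)} := by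
      refine lt_of_le_of_ne le_sup_left fun h => hc ?_
      rw [h]
      exact Submodule.mem_sup_right (Submodule.mem_span_singleton_self _)
    have h2 := Submodule.finrank_lt_finrank_of_lt h1
    have h3 := Submodule.finrank_le (U ⊔ Submodule.span ℂ {Pi.single c (1 : ℂ)})
    rw [Module.finrank_fintype_fun_eq_card, Fintype.card_fin] at h3
    omega
  have hl : ∀ b : Fin n, ∃ a : ℂ, Pi.single b (1 : ℂ) - a • Pi.single c (1 : ℂ) ∈ U := by
    intro b
    have h1 : Pi.single b (1 : ℂ) ∈ U ⊔ Submodule.span ℂ {Pi.single c (1 : ℂ)} := by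
      rw [hsup]
      exact Submodule.mem_top
    obtain ⟨u, hu, w, hw, huw⟩ := Submodule.mem_sup.mp h1
    obtain ⟨a, rfl⟩ := Submodule.mem_span_singleton.mp hw
    refine ⟨a, ?_⟩
    rw [← huw, add_sub_cancel_right]
    exact hu
  choose a ha using hl
  -- The form is evaluated on the vectors `e_b - a_b e_c` of `U`, for `b` outside `{c, c.rev}`. Any
  -- term other than `J` uses `c` but not `c.rev`, while the support of `t` consists of tuples whose
  -- range is stable under reversal; so the value is 1.
  set J := complPair hn hd c with hJ
  have hJr : Set.range J = {c, c.rev}ᶜ := range_complPair hn hd c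
  have h0 := hiso (fun s => Pi.single (J s) 1 - a (J s) • Pi.single c 1) fun s => ha (J s)
  have hJc : ∀ s, J s ≠ c ∧ J s ≠ c.rev := by
    intro s
    have : J s ∈ ({c, c.rev}ᶜ : Set (Fin n)) := by
      rw [← hJr]
      exact ⟨s, rfl⟩
    simpa using this
  rw [arrayForm_apply, Finset.sum_eq_single (J : Fin d → Fin n)] at h0
  · have h1 : t J = 1 := by
      rw [htx ⟨J, J.strictMono⟩]
      exact if_pos ⟨c, hJr⟩
    rw [h1, mul_one, Finset.prod_eq_one] at h0
    · exact one_ne_zero h0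
    · intro s _
      simp [(hJc s).1]
  · intro I _ hI
    by_contra hne
    have hI' : ∀ s, I s = J s ∨ I s = c := by
      intro s
      have h1 := (Finset.prod_ne_zero_iff.mp (left_ne_zero_of_mul hne)) s (Finset.mem_univ s)
      by_contra! hcon
      simp [hcon.1, hcon.2] at h1
    obtain ⟨i, hi⟩ := htr I (right_ne_zero_of_mul hne)
    obtain ⟨s, hs⟩ := Function.ne_iff.mp hI
    have hIc : c ∈ Set.range I := ⟨s, (hI' s).resolve_left hs⟩
    have hIrev : c.rev ∉ Set.range I := by
      rintro ⟨s', hs'⟩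
      rcases hI' s' with h | h
      · exact (hJc s').2 (by rw [← h, hs'])
      · exact fin_ne_rev hn c (by rw [← hs', h])
    rw [hi] at hIc hIrev
    simp only [Set.mem_compl_iff, Set.mem_insert_iff, Set.mem_singleton_iff, not_or] at hIc hIrev
    exact hIrev ⟨fun h => hIc.2 (by rw [← h, Fin.rev_rev]), fun h => hIc.1 (Fin.rev_injective h)⟩
  · simp

theorem range_eq_compl_singleton {d k : ℕ} (hk : d + 1 = k) {I : Fin d → Fin k}
    (hI : Function.Injective I) : ∃ x, Set.range I = {x}ᶜ := by
  classical
  have h1 : (Finset.univ.image I)ᶜ.card = 1 := by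
    rw [Finset.card_compl, Finset.card_image_of_injective _ hI, Fintype.card_fin,
      Finset.card_univ, Fintype.card_fin]
    omega
  obtain ⟨x, hx⟩ := Finset.card_eq_one.mp h1
  refine ⟨x, ?_⟩
  have h2 := congrArg (fun s : Finset (Fin k) => (s : Set (Fin k))ᶜ) hx
  simpa using h2

/-- A single separating array, of degree `k - 2`, for skew-symmetric arrays of degree `k - 1`. -/
theorem hasSeparatingArrays_of_even {d k : ℕ} (hk : Even k) (hd : d + 2 = k) :
    HasSeparatingArrays true d k 1 := by
  classical
  refine ⟨fun _ => ∑ c, Pi.single (complPair hk hd c : Fin d → Fin k) 1, fun g hg hgf => ?_⟩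
  have hrange : ∀ c, Set.range (complPair hk hd c) = {c, c.rev}ᶜ := range_complPair hk hd
  have hnotinj : ∀ i c, c ≠ i → c ≠ i.rev →
      g (Fin.cons i (complPair hk hd c : Fin d → Fin k)) = 0 := by
    intro i c h1 h2
    refine apply_eq_zero_of_not_injective hg fun hinj => ?_
    have h3 : i ∈ Set.range (complPair hk hd c) := by
      rw [hrange]
      simp only [Set.mem_compl_iff, Set.mem_insert_iff, Set.mem_singleton_iff, not_or]
      exact ⟨h1.symm, fun h => h2 (by rw [h, Fin.rev_rev])⟩
    exact (Fin.cons_injective_iff.mp hinj).1 h3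
  have hrev : ∀ i, complPair hk hd i.rev = complPair hk hd i := by
    intro i
    have h1 : Set.range (complPair hk hd i.rev) = Set.range (complPair hk hd i) := by
      rw [hrange, hrange, Fin.rev_rev, Set.pair_comm]
    exact DFunLike.coe_injective
      (((complPair hk hd i.rev).strictMono.range_inj (complPair hk hd i).strictMono).mp h1)
  have hg0 : ∀ i, g (Fin.cons i (complPair hk hd i : Fin d → Fin k)) = 0 := by
    intro i
    have h1 := hgf i 0
    have h2 : ∑ I, g (Fin.cons i I) *
        (∑ c, Pi.single (complPair hk hd c : Fin d → Fin k) 1 : (Fin d → Fin k) → ℂ) I =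
        ∑ c, g (Fin.cons i (complPair hk hd c : Fin d → Fin k)) := by
      simp only [Finset.sum_apply, Finset.mul_sum]
      rw [Finset.sum_comm]
      refine Finset.sum_congr rfl fun c _ => ?_
      rw [Finset.sum_eq_single (complPair hk hd c : Fin d → Fin k)]
      · simp
      · intro I _ hI
        rw [Pi.single_eq_of_ne hI, mul_zero]
      · simp
    -- Each pair is counted twice in the sum over `c`; the two surviving terms agree and do not
    -- cancel.
    rw [h2, Finset.sum_eq_add i i.rev (fin_ne_rev hk i)
      (fun c _ hc => hnotinj i c hc.1 hc.2) (by simp) (by simp), hrev, ← two_mul] at h1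
    exact (mul_eq_zero.mp h1).resolve_left two_ne_zero
  ext I
  by_contra hI
  have hinj : Function.Injective I := by
    by_contra h
    exact hI (apply_eq_zero_of_not_injective hg h)
  obtain ⟨x, hx⟩ := range_eq_compl_singleton (by omega) hinj
  -- An injective tuple misses exactly one index `x`, so it is a rearrangement of this one, at which
  -- `g` vanishes by `hg0`.
  set L : Fin (d + 1) → Fin k := Fin.cons x.rev (complPair hk hd x.rev : Fin d → Fin k) with hL
  have hLr : Set.range L = {x}ᶜ := by
    rw [hL, Fin.range_cons, hrange, Fin.rev_rev]
    ext i
    simp only [Set.mem_insert_iff, Set.mem_compl_iff, Set.mem_singleton_iff, not_or]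
    constructor
    · rintro (h | h)
      · rw [h]
        exact (fin_ne_rev hk x).symm
      · exact h.2
    · intro h
      by_cases h' : i = x.rev
      · exact Or.inl h'
      · exact Or.inr ⟨h', h⟩
  have hLinj : Function.Injective L := by
    rw [hL, Fin.cons_injective_iff, hrange]
    exact ⟨by simp, (complPair hk hd x.rev).injective⟩
  set σ : Equiv.Perm (Fin (d + 1)) := (Equiv.ofInjective I hinj).trans
    ((Equiv.setCongr (hx.trans hLr.symm)).trans (Equiv.ofInjective L hLinj).symm) with hσ
  have hσI : L ∘ σ = I := by
    ext1 s
    have h1 := Equiv.apply_ofInjective_symm hLinj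
      (Equiv.setCongr (hx.trans hLr.symm) (Equiv.ofInjective I hinj s))
    exact h1
  apply hI
  rw [← hσI, hg σ L, hL, hg0, mul_zero]
  rfl

end corankTwo

/-! ### The `G₂`-form in dimension seven. -/

section dimensionSeven

/-- The index triples of the standard generic skew-symmetric form of degree three in dimension
seven, whose stabilizer has the identity component `G₂`. -/
def g2Triple : Fin 5 → Fin 3 → Fin 7 :=
  ![![0, 1, 4], ![0, 2, 5], ![0, 3, 6], ![1, 2, 3], ![4, 5, 6]]

/-- The standard generic skew-symmetric form of degree three in dimension seven. -/
noncomputable def g2Form : (Fin 7 → ℂ) [⋀^Fin 3]→ₗ[ℂ] ℂ :=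
  ∑ a, (Matrix.detRowAlternating (R := ℂ) (n := Fin 3)).compLinearMap
    (LinearMap.funLeft ℂ ℂ (g2Triple a))

theorem g2Form_apply (v : Fin 3 → Fin 7 → ℂ) :
    g2Form v = ∑ a, Matrix.det (Matrix.of fun s c => v s (g2Triple a c)) := by
  simp only [g2Form, Fin.sum_univ_five]
  rfl

/-- The vector `g2Map u v` represents the linear form `g2Form u v ·`. -/
noncomputable def g2Map (u : Fin 7 → ℂ) : (Fin 7 → ℂ) →ₗ[ℂ] (Fin 7 → ℂ) where
  toFun v := ![u 1 * v 4 - u 4 * v 1 + (u 2 * v 5 - u 5 * v 2) + (u 3 * v 6 - u 6 * v 3),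
    u 4 * v 0 - u 0 * v 4 + (u 2 * v 3 - u 3 * v 2),
    u 5 * v 0 - u 0 * v 5 + (u 3 * v 1 - u 1 * v 3),
    u 6 * v 0 - u 0 * v 6 + (u 1 * v 2 - u 2 * v 1),
    u 0 * v 1 - u 1 * v 0 + (u 5 * v 6 - u 6 * v 5),
    u 0 * v 2 - u 2 * v 0 + (u 6 * v 4 - u 4 * v 6),
    u 0 * v 3 - u 3 * v 0 + (u 4 * v 5 - u 5 * v 4)]
  map_add' v w := by
    ext i
    fin_cases i <;> simp <;> ring
  map_smul' c v := by
    ext i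
    fin_cases i <;> simp <;> ring

theorem dotProduct_g2Map (u v w : Fin 7 → ℂ) : w ⬝ᵥ g2Map u v = g2Form ![u, v, w] := by
  rw [g2Form_apply, Fin.sum_univ_five]
  rw [Matrix.det_fin_three, Matrix.det_fin_three, Matrix.det_fin_three, Matrix.det_fin_three,
    Matrix.det_fin_three]
  simp only [dotProduct, Fin.sum_univ_seven]
  simp [g2Map, g2Triple]
  ring

/-- The quadratic form invariant under the stabilizer of `g2Form`. -/
def g2Quadric (u : Fin 7 → ℂ) : ℂ := u 0 ^ 2 - (u 1 * u 4 + u 2 * u 5 + u 3 * u 6)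

theorem ker_g2Map_le {u : Fin 7 → ℂ} (hu : g2Quadric u ≠ 0) :
    LinearMap.ker (g2Map u) ≤ Submodule.span ℂ {u} := by
  intro v hv
  rw [LinearMap.mem_ker] at hv
  have h0 := congrFun hv 0
  have h1 := congrFun hv 1
  have h2 := congrFun hv 2
  have h3 := congrFun hv 3
  have h4 := congrFun hv 4
  have h5 := congrFun hv 5
  have h6 := congrFun hv 6
  simp [g2Map] at h0 h1 h2 h3 h4 h5 h6
  rw [Submodule.mem_span_singleton]
  -- Modulo the equation `h0` this numerator is half the polar form of `g2Quadric` at `u, v`, as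
  -- suggested by the double cross product identity.
  refine ⟨(u 0 * v 0 - (u 4 * v 1 + u 5 * v 2 + u 6 * v 3)) / g2Quadric u, ?_⟩
  have key : ∀ i, g2Quadric u * v i =
      (u 0 * v 0 - (u 4 * v 1 + u 5 * v 2 + u 6 * v 3)) * u i := by
    intro i
    simp only [g2Quadric]
    fin_cases i <;> simp only [Fin.zero_eta, Fin.mk_one, Fin.reduceFinMk]
    · linear_combination u 4 * h4 + u 5 * h5 + u 6 * h6
    · linear_combination u 0 * h4 + (u 5 * h3 - u 6 * h2)
    · linear_combination u 0 * h5 + (u 6 * h1 - u 4 * h3)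
    · linear_combination u 0 * h6 + (u 4 * h2 - u 5 * h1)
    · linear_combination - u 0 * h1 + (u 2 * h6 - u 3 * h5) - u 4 * h0
    · linear_combination - u 0 * h2 + (u 3 * h4 - u 1 * h6) - u 5 * h0
    · linear_combination - u 0 * h3 + (u 1 * h5 - u 2 * h4) - u 6 * h0
  ext i
  rw [Pi.smul_apply, smul_eq_mul, div_mul_eq_mul_div, ← key, mul_div_cancel_left₀ _ hu]

/-- The linear map representing the polar form of `g2Quadric`. -/
noncomputable def g2Polar : (Fin 7 → ℂ) →ₗ[ℂ] (Fin 7 → ℂ) where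
  toFun v := ![2 * v 0, - v 4, - v 5, - v 6, - v 1, - v 2, - v 3]
  map_add' v w := by
    ext i
    fin_cases i <;> simp <;> ring
  map_smul' c v := by
    ext i
    fin_cases i <;> simp <;> ring

theorem dotProduct_g2Polar (u v : Fin 7 → ℂ) :
    u ⬝ᵥ g2Polar v = g2Quadric (u + v) - g2Quadric u - g2Quadric v := by
  simp only [dotProduct, Fin.sum_univ_seven]
  simp [g2Polar, g2Quadric]
  ring

theorem ker_g2Polar : LinearMap.ker g2Polar = ⊥ := by
  rw [LinearMap.ker_eq_bot']
  intro v hv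
  have h0 := congrFun hv 0
  have h1 := congrFun hv 1
  have h2 := congrFun hv 2
  have h3 := congrFun hv 3
  have h4 := congrFun hv 4
  have h5 := congrFun hv 5
  have h6 := congrFun hv 6
  simp [g2Polar] at h0 h1 h2 h3 h4 h5 h6
  ext i
  fin_cases i <;> assumption

/-- If `u ∈ U` has `g2Quadric u ≠ 0`, then `g2Form u · ·` has kernel at most the line of `u`, so its
isotropic subspaces have dimension at most 4. Hence the quadric vanishes on `U`; being
nondegenerate, it allows dimension at most 3. -/
theorem not_hasIsotropicSubspace_g2Form : ¬ HasIsotropicSubspace g2Form.toMultilinearMap 5 := by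
  rintro ⟨U, hU, h⟩
  have hW : ∀ u ∈ U, ∀ v ∈ U, ∀ w ∈ U, v ⬝ᵥ g2Map u w = 0 := by
    intro u hu v hv w hw
    rw [dotProduct_g2Map]
    exact h _ fun i => by fin_cases i <;> simpa
  have hQ : ∀ u ∈ U, g2Quadric u = 0 := by
    intro u hu
    by_contra hne
    have h1 := two_mul_finrank_le_of_isotropic (g2Map u) (hW u hu)
    have h2 := (Submodule.finrank_mono (ker_g2Map_le hne)).trans
      ((finrank_span_le_card _).trans_eq (Set.toFinset_card _))
    rw [Fintype.card_unique] at h2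
    omega
  have h1 := two_mul_finrank_le_of_isotropic (U := U) g2Polar fun u hu v hv => by
    rw [dotProduct_g2Polar, hQ u hu, hQ v hv, hQ _ (U.add_mem hu hv), sub_zero, sub_zero]
  rw [ker_g2Polar, finrank_bot] at h1
  omega

theorem exists_not_hasIsotropicRows_seven : ∃ t ∈ symArray true 3 (Fin 7), ¬ HasIsotropicRows t 5 :=
  ⟨_, (alternatingCoord (Pi.basisFun ℂ (Fin 7)) g2Form).2, fun h =>
    not_hasIsotropicSubspace_g2Form ((hasIsotropicSubspace_iff (Pi.basisFun ℂ (Fin 7)) _ 5).mpr h)⟩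

end dimensionSeven

theorem hasSeparatingArrays_zero (ε : Bool) {k m : ℕ} (hm : 1 ≤ m) :
    HasSeparatingArrays ε 0 k m := by
  refine ⟨fun _ _ => 1, fun g _ h => ?_⟩
  ext I
  have h1 := h (I 0) ⟨0, hm⟩
  rw [Fintype.sum_unique, mul_one] at h1
  rw [← Fin.cons_self_tail I, Subsingleton.elim (Fin.tail I) default]
  exact h1

/-! ### Convexity and binomial inequalities. -/

section numerics

/-- The differences increase: if the one at `r` is nonnegative, `f` is nondecreasing from `r` to
`b`; otherwise it decreases from `a` to `r`. -/
theorem le_of_discretely_convex {f : ℕ → ℤ} (hf : ∀ r, 2 * f (r + 1) ≤ f r + f (r + 2)) {a b r : ℕ}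
    {B : ℤ} (ha : f a ≤ B) (hb : f b ≤ B) (har : a ≤ r) (hrb : r ≤ b) : f r ≤ B := by
  have hg : Monotone fun r => f (r + 1) - f r := monotone_nat_of_le_succ fun r => by
    have := hf r
    change f (r + 1) - f r ≤ f (r + 2) - f (r + 1)
    linarith
  rcases le_or_gt 0 (f (r + 1) - f r) with h | h
  · refine le_trans ?_ hb
    induction b, hrb using Nat.le_induction with
    | base => exact le_rfl
    | succ s hs ih =>
      have h1 : f (r + 1) - f r ≤ f (s + 1) - f s := hg hs
      by_cases hsB : f s ≤ B
      · linarith [ih hsB]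
      · have h2 : f r ≤ f s := by
          clear ih hsB hb h1
          induction s, hs using Nat.le_induction with
          | base => exact le_rfl
          | succ s hs ih =>
            have h1 : f (r + 1) - f r ≤ f (s + 1) - f s := hg hs
            linarith
        linarith
  · have key : ∀ s, s ≤ r → f r ≤ f (r - s) := by
      intro s hs
      induction s with
      | zero => exact le_rfl
      | succ s ih =>
        have h1 : f (r - (s + 1) + 1) - f (r - (s + 1)) ≤ f (r + 1) - f r := hg (by omega)
        rw [show r - (s + 1) + 1 = r - s by omega] at h1
        linarith [ih (by omega)]
    have := key (r - a) (by omega)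
    rw [show r - (r - a) = a by omega] at this
    linarith

theorem discretely_convex_choose (e p K D : ℕ) (r : ℕ) :
    2 * (((p + (r + 1)).choose (e + 1) : ℤ) + D * ((K : ℤ) - ((r + 1 : ℕ) : ℤ))) ≤
      (((p + r).choose (e + 1) : ℤ) + D * ((K : ℤ) - (r : ℤ))) +
      (((p + (r + 2)).choose (e + 1) : ℤ) + D * ((K : ℤ) - ((r + 2 : ℕ) : ℤ))) := by
  have h1 := Nat.choose_succ_succ' (p + r) e
  have h2 := Nat.choose_succ_succ' (p + r + 1) e
  have h3 : (p + r).choose e ≤ (p + r + 1).choose e := Nat.choose_le_choose e (by omega)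
  rw [show p + (r + 1) = p + r + 1 by omega, show p + (r + 2) = p + r + 1 + 1 by omega]
  push_cast
  zify at h1 h2 h3
  linarith

theorem le_choose_succ (e j : ℕ) : j ≤ (e + j).choose (e + 1) := by
  induction e with
  | zero => simp
  | succ e ih =>
    have h := Nat.choose_succ_succ' (e + j) (e + 1)
    rw [show e + 1 + j = e + j + 1 by omega]
    omega

/-- When `e` grows by 1, the left side grows by `c`, and by Pascal the right side grows by at least
`j`. -/
theorem lt_choose_of_base {e₀ e j : ℕ} (c : ℕ) (he : e₀ ≤ e) (hc : c ≤ j)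
    (h : (e₀ + 1) * c < (e₀ + j).choose e₀) : (e + 1) * c < (e + j).choose e := by
  induction e, he using Nat.le_induction with
  | base => exact h
  | succ e _ ih =>
    have h1 := Nat.choose_succ_succ' (e + j) e
    have h2 := le_choose_succ e j
    rw [show e + 1 + j = e + j + 1 by omega]
    nlinarith

theorem choose_two_mul_two (s : ℕ) : (s + 2).choose 2 * 2 = (s + 2) * (s + 1) := by
  have := Nat.add_one_mul_choose_eq (s + 1) 1
  rw [Nat.choose_one_right] at this
  linarith

theorem symmetric_lt_choose {e k : ℕ} (he : 2 ≤ e) (hk : 1 ≤ k) :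
    (e + 1) * (k - 1) < (e + k).choose e := by
  refine lt_choose_of_base (k - 1) he (by omega) ?_
  obtain ⟨k, rfl⟩ := Nat.exists_eq_add_of_le' hk
  have := choose_two_mul_two (k + 1)
  rw [Nat.add_sub_cancel, show 2 + (k + 1) = k + 1 + 2 by omega]
  nlinarith [Nat.le_mul_self k]

/-- At `e = j = 2` both sides equal 6, which is the source of the exception in dimension seven. For
`j = 2` the induction therefore starts at `e = 3`. -/
theorem alternating_lt_choose {e j : ℕ} (he : 2 ≤ e) (hj : 2 ≤ j) (hne : ¬ (e = 2 ∧ j = 2)) :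
    (e + 1) * j < (e + j).choose e := by
  rcases Nat.lt_or_ge 2 j with h | h
  · refine lt_choose_of_base j he le_rfl ?_
    have := choose_two_mul_two j
    rw [show 2 + j = j + 2 by omega]
    nlinarith
  · obtain rfl : j = 2 := by omega
    exact lt_choose_of_base (e₀ := 3) 2 (by omega) le_rfl (by decide)

end numerics

/-! ### Existence of separating arrays in the required range. -/

section separating

variable {d k m : ℕ}

/-- Multiplied by `(d + 1) / r`, the rank condition becomes `(d + r).choose d + (d + 1) (k - r) ≤ (d
+ 1) m`, convex in `r`. At `r = k` it is the hypothesis; at `r = 1` it is `k ≤ m`, which follows. -/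
theorem hasSeparatingArrays_symmetric (hd : 2 ≤ d) (hk : 1 ≤ k)
    (h : formDim false (d + 1) k ≤ k * m) : HasSeparatingArrays false d k m := by
  have hform : ∀ r, formDim false (d + 1) r * (d + 1) = r * (d + r).choose d := by
    intro r
    have := Nat.choose_succ_right_eq (d + r) d
    rw [Nat.add_sub_cancel_left] at this
    rw [formDim, if_neg Bool.false_ne_true, show d + 1 + r - 1 = d + r by omega, this, mul_comm]
  have hm : (d + k).choose d ≤ (d + 1) * m := by
    have h1 := Nat.mul_le_mul_right (d + 1) h
    rw [hform, mul_assoc] at h1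
    rw [mul_comm (d + 1)]
    exact Nat.le_of_mul_le_mul_left h1 hk
  have hkm : k ≤ m := by
    have h1 := (symmetric_lt_choose hd hk).trans_le hm
    have := Nat.lt_of_mul_lt_mul_left h1
    omega
  refine hasSeparatingArrays_of_forall_rank false d k m fun r hr hrk _ => ?_
  obtain ⟨e, rfl⟩ : ∃ e, d = e + 1 := ⟨d - 1, by omega⟩
  have key := le_of_discretely_convex
    (f := fun r => ((e + 1 + r).choose (e + 1) : ℤ) + ((e + 1 + 1 : ℕ) : ℤ) * ((k : ℤ) - (r : ℤ)))
    (discretely_convex_choose e (e + 1) k (e + 1 + 1)) (a := 1) (b := k) (r := r)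
    (B := ((e + 1 + 1 : ℕ) : ℤ) * m) (by
      rw [Nat.choose_succ_self_right]
      push_cast
      have : (k : ℤ) ≤ m := by exact_mod_cast hkm
      nlinarith) (by
      simp only [sub_self, mul_zero, add_zero]
      exact_mod_cast hm) hr hrk
  have h1 := hform r
  have h2 : (r * (k - r) + formDim false (e + 1 + 1) r) * (e + 1 + 1) ≤ r * m * (e + 1 + 1) := by
    rw [add_mul, h1]
    zify [hrk]
    have := mul_le_mul_of_nonneg_left key (Nat.cast_nonneg (α := ℤ) r)
    push_cast at this
    linarith
  exact Nat.le_of_mul_le_mul_right h2 (by omega)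

/-- The same convexity argument, with smallest rank `r = d + 1`; there the condition follows from
`hkm`. -/
theorem hasSeparatingArrays_alternating_of_lt (hd : 1 ≤ d) (hkm : k < m + (d + 1))
    (h : formDim true (d + 1) k ≤ k * m) : HasSeparatingArrays true d k m := by
  have hform : ∀ s, formDim true (d + 1) (s + 1) * (d + 1) = (s + 1) * s.choose d := by
    intro s
    rw [formDim, if_pos rfl, ← Nat.add_one_mul_choose_eq]
  refine hasSeparatingArrays_of_forall_rank true d k m fun r hr hrk hdr => ?_
  specialize hdr rfl
  obtain ⟨e, rfl⟩ : ∃ e, d = e + 1 := ⟨d - 1, by omega⟩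
  obtain ⟨K, rfl⟩ : ∃ K, k = K + 1 := ⟨k - 1, by omega⟩
  obtain ⟨s, rfl⟩ : ∃ s, r = s + 1 := ⟨r - 1, by omega⟩
  have hm : K.choose (e + 1) ≤ (e + 1 + 1) * m := by
    have h1 := Nat.mul_le_mul_right (e + 1 + 1) h
    rw [hform, mul_assoc] at h1
    rw [mul_comm (e + 1 + 1)]
    exact Nat.le_of_mul_le_mul_left h1 (by omega)
  have hconv := discretely_convex_choose e 0 K (e + 1 + 1)
  simp only [zero_add] at hconv
  have key := le_of_discretely_convex
    (f := fun r => (r.choose (e + 1) : ℤ) + ((e + 1 + 1 : ℕ) : ℤ) * ((K : ℤ) - (r : ℤ)))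
    hconv (a := e + 1) (b := K) (r := s)
    (B := ((e + 1 + 1 : ℕ) : ℤ) * m) (by
      rw [Nat.choose_self]
      push_cast
      have : (K : ℤ) + 1 ≤ m + (e + 1) := by
        have : K + 1 ≤ m + (e + 1) := by omega
        exact_mod_cast this
      nlinarith) (by
      simp only [sub_self, mul_zero, add_zero]
      exact_mod_cast hm) (by omega) (by omega)
  have h2 : ((s + 1) * (K + 1 - (s + 1)) + formDim true (e + 1 + 1) (s + 1)) * (e + 1 + 1) ≤
      (s + 1) * m * (e + 1 + 1) := by
    rw [add_mul, hform]
    zify [hrk]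
    have := mul_le_mul_of_nonneg_left key (Nat.cast_nonneg (α := ℤ) (s + 1))
    push_cast at this
    linarith
  exact Nat.le_of_mul_le_mul_right h2 (by omega)

/-- Otherwise `k = d + 1 + j` with `m ≤ j`, and the hypothesis contradicts `alternating_lt_choose`
unless `j = m = 1` or `d = j = 2`. In the first case `k` is even by `hex`, and the explicit array
applies; the second is excluded by `hex'`. -/
theorem hasSeparatingArrays_alternating (hd : 2 ≤ d) (h : formDim true (d + 1) k ≤ k * m)
    (hex : ¬ (d + 1 + 2 = k + m ∧ Even (k + m))) (hex' : ¬ (d + 1 = 3 ∧ k + m = 7)) :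
    HasSeparatingArrays true d k m := by
  by_cases hkm : k < m + (d + 1)
  · exact hasSeparatingArrays_alternating_of_lt (by omega) hkm h
  obtain ⟨j, rfl⟩ : ∃ j, k = d + 1 + j := ⟨k - (d + 1), by omega⟩
  have hc : (d + j).choose d ≤ (d + 1) * m := by
    have h1 := Nat.mul_le_mul_right (d + 1) h
    rw [formDim, if_pos rfl, show d + 1 + j = d + j + 1 by omega, ← Nat.add_one_mul_choose_eq,
      mul_assoc] at h1
    rw [mul_comm (d + 1)]
    exact Nat.le_of_mul_le_mul_left h1 (by omega)
  have hmj : m ≤ j := by omega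
  have hm0 : m ≠ 0 := by
    rintro rfl
    have := Nat.choose_pos (Nat.le_add_right d j)
    omega
  rcases Nat.lt_or_ge j 2 with hj | hj
  · obtain rfl : j = 1 := by omega
    obtain rfl : m = 1 := by omega
    refine hasSeparatingArrays_of_even ?_ rfl
    by_contra hodd
    refine hex ⟨rfl, ?_⟩
    rw [Nat.even_add_one]
    exact hodd
  · by_cases hne : d = 2 ∧ j = 2
    · obtain ⟨rfl, rfl⟩ := hne
      have h6 : (2 + 2).choose 2 = 6 := by decide
      omega
    · have h1 := (alternating_lt_choose hd hj hne).trans_le hc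
      have := Nat.lt_of_mul_lt_mul_left h1
      omega

theorem hasSeparatingArrays_symmetric_two (h : k ≤ m) : HasSeparatingArrays false 1 k m := by
  refine hasSeparatingArrays_of_forall_rank false 1 k m fun r hr hrk _ => ?_
  obtain ⟨s, rfl⟩ := Nat.exists_eq_add_of_le' hr
  obtain ⟨p, rfl⟩ := Nat.exists_eq_add_of_le hrk
  have := choose_two_mul_two s
  rw [formDim, if_neg Bool.false_ne_true, Nat.add_sub_cancel_left,
    show 1 + 1 + (s + 1) - 1 = s + 2 by omega]
  nlinarith

theorem hasSeparatingArrays_alternating_two (h : k ≤ m + 1) : HasSeparatingArrays true 1 k m := by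
  refine hasSeparatingArrays_of_forall_rank true 1 k m fun r _ hrk hr => ?_
  obtain ⟨s, rfl⟩ := Nat.exists_eq_add_of_le' (hr rfl)
  obtain ⟨p, rfl⟩ := Nat.exists_eq_add_of_le hrk
  have := choose_two_mul_two s
  rw [formDim, if_pos rfl, Nat.add_sub_cancel_left]
  nlinarith

end separating

/-! ### Assembly of the cases. -/

section generic

variable {d n k : ℕ}

theorem div_add_le_iff {F : ℕ} (hk : 1 ≤ k) :
    (F : ℚ) / (k : ℚ) + (k : ℚ) ≤ (n : ℚ) ↔ k ≤ n ∧ F ≤ k * (n - k) := by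
  have hk0 : (0 : ℚ) < k := by exact_mod_cast hk
  have hF : (0 : ℚ) ≤ F := Nat.cast_nonneg F
  have key : k ≤ n → ((F : ℚ) / (k : ℚ) + (k : ℚ) ≤ (n : ℚ) ↔ F ≤ k * (n - k)) := by
    intro h
    rw [← le_sub_iff_add_le, div_le_iff₀ hk0, ← Nat.cast_sub h, mul_comm]
    exact_mod_cast Iff.rfl
  constructor
  · intro h
    have h1 : k ≤ n := by
      have : (0 : ℚ) ≤ F / k := by positivity
      have h2 : (k : ℚ) ≤ n := by linarith
      exact_mod_cast h2
    exact ⟨h1, (key h1).mp h⟩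
  · rintro ⟨h1, h2⟩
    exact (key h1).mpr h2

theorem exists_not_hasIsotropicRows_of_not_le (ε : Bool) (hk : 1 ≤ k)
    (h : ¬ ((formDim ε d k : ℚ) / (k : ℚ) + (k : ℚ) ≤ (n : ℚ))) :
    ∃ t ∈ symArray ε d (Fin n), ¬ HasIsotropicRows t k := by
  rw [div_add_le_iff hk] at h
  by_cases hkn : k ≤ n
  · exact exists_not_hasIsotropicRows ε (not_le.mp fun h' => h ⟨hkn, h'⟩)
  · refine ⟨0, Submodule.zero_mem _, fun h' => hkn ?_⟩
    simpa using h'.le_card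

end generic

section main

variable {V : Type*} [AddCommGroup V] [Module ℂ V] [FiniteDimensional ℂ V] {n d k : ℕ}

theorem SymForm.holdsGenerically_hasIsotropicSubspace_iff (hn : Module.finrank ℂ V = n)
    (hd : 1 ≤ d) (hk : 1 ≤ k) (hd2 : d ≠ 2) : HoldsGenerically fun w : SymForm d V =>
      (HasIsotropicSubspace (w : MultilinearMap ℂ (fun _ : Fin d => V) ℂ) k ↔
        (formDim false d k : ℚ) / (k : ℚ) + (k : ℚ) ≤ (n : ℚ)) := by
  refine SymForm.holdsGenerically_iff hn (fun h => ?_)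
    (exists_not_hasIsotropicRows_of_not_le false hk)
  obtain ⟨hkn, h⟩ := (div_add_le_iff hk).mp h
  obtain ⟨d, rfl⟩ := Nat.exists_eq_add_of_le' hd
  refine HasSeparatingArrays.hasIsotropicRows_fin hkn ?_
  rcases Nat.eq_zero_or_pos d with rfl | hd0
  · refine hasSeparatingArrays_zero false ?_
    rw [formDim, if_neg Bool.false_ne_true, zero_add, Nat.add_sub_cancel_left,
      Nat.choose_one_right] at h
    exact Nat.pos_of_ne_zero fun h0 => by simp [h0] at h; omega
  · exact hasSeparatingArrays_symmetric (by omega) hk h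

theorem SymForm.holdsGenerically_two (hn : Module.finrank ℂ V = n) (hk : 1 ≤ k) :
    HoldsGenerically fun w : SymForm 2 V =>
      (HasIsotropicSubspace (w : MultilinearMap ℂ (fun _ : Fin 2 => V) ℂ) k ↔ 2 * k ≤ n) :=
  SymForm.holdsGenerically_iff hn
    (fun h => HasSeparatingArrays.hasIsotropicRows_fin (by omega)
      (hasSeparatingArrays_symmetric_two (by omega)))
    fun h => exists_symmetric_not_hasIsotropicRows (not_le.mp h)

theorem AlternatingMap.holdsGenerically_hasIsotropicSubspace_iff (hn : Module.finrank ℂ V = n)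
    (hd : 1 ≤ d) (hk : 1 ≤ k) (hd2 : d ≠ 2) (hex : ¬ (d + 2 = n ∧ Even n))
    (hex' : ¬ (d = 3 ∧ n = 7)) : HoldsGenerically fun w : V [⋀^Fin d]→ₗ[ℂ] ℂ =>
      (HasIsotropicSubspace w.toMultilinearMap k ↔
        (formDim true d k : ℚ) / (k : ℚ) + (k : ℚ) ≤ (n : ℚ)) := by
  refine AlternatingMap.holdsGenerically_iff hn (fun h => ?_)
    (exists_not_hasIsotropicRows_of_not_le true hk)
  obtain ⟨hkn, h⟩ := (div_add_le_iff hk).mp h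
  obtain ⟨d, rfl⟩ := Nat.exists_eq_add_of_le' hd
  refine HasSeparatingArrays.hasIsotropicRows_fin hkn ?_
  rcases Nat.eq_zero_or_pos d with rfl | hd0
  · refine hasSeparatingArrays_zero true ?_
    rw [formDim, if_pos rfl, zero_add, Nat.choose_one_right] at h
    exact Nat.pos_of_ne_zero fun h0 => by simp [h0] at h; omega
  · refine hasSeparatingArrays_alternating (by omega) h ?_ ?_
    · rwa [Nat.add_sub_cancel' hkn]
    · rwa [Nat.add_sub_cancel' hkn]

theorem AlternatingMap.holdsGenerically_two (hn : Module.finrank ℂ V = n) (hk : 1 ≤ k) :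
    HoldsGenerically fun w : V [⋀^Fin 2]→ₗ[ℂ] ℂ =>
      (HasIsotropicSubspace w.toMultilinearMap k ↔ 2 * k ≤ n + if Even n then 0 else 1) :=
  AlternatingMap.holdsGenerically_iff hn
    (fun h => HasSeparatingArrays.hasIsotropicRows_fin (by split_ifs at h <;> omega)
      (hasSeparatingArrays_alternating_two (by split_ifs at h <;> omega)))
    fun h => exists_alternating_not_hasIsotropicRows (not_le.mp h)

theorem AlternatingMap.holdsGenerically_corank_two (hn : Module.finrank ℂ V = n) (hd : 1 ≤ d)
    (hdn : d + 2 = n) (heven : Even n) : HoldsGenerically fun w : V [⋀^Fin d]→ₗ[ℂ] ℂ =>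
      (HasIsotropicSubspace w.toMultilinearMap k ↔ k ≤ n - 2) := by
  refine AlternatingMap.holdsGenerically_iff hn (fun h => ?_) fun h => ?_
  · obtain ⟨d, rfl⟩ := Nat.exists_eq_add_of_le' hd
    refine HasSeparatingArrays.hasIsotropicRows_fin (by omega)
      (hasSeparatingArrays_of_forall_rank true d k (n - k) fun r hr hrk hdr => ?_)
    -- Since `k ≤ n - 2 = d + 1`, only the rank `r = k = d + 1` can occur; smaller `k` impose no
    -- condition.
    obtain rfl : r = d + 1 := le_antisymm (by omega) (hdr rfl)
    obtain rfl : k = d + 1 := le_antisymm (by omega) hrk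
    rw [formDim, if_pos rfl, Nat.choose_self, Nat.sub_self, show n - (d + 1) = 2 by omega]
    omega
  · obtain ⟨t, ht, htk⟩ := exists_not_hasIsotropicRows_corank_two heven hdn
    exact ⟨t, ht, fun h' => htk (h'.mono (by omega))⟩

theorem AlternatingMap.holdsGenerically_three_of_finrank_eq_seven (hn : Module.finrank ℂ V = 7) :
    HoldsGenerically fun w : V [⋀^Fin 3]→ₗ[ℂ] ℂ =>
      (HasIsotropicSubspace w.toMultilinearMap k ↔ k ≤ 4) := by
  refine AlternatingMap.holdsGenerically_iff hn (fun h => ?_) fun h => ?_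
  · refine HasSeparatingArrays.hasIsotropicRows_fin (by omega)
      (hasSeparatingArrays_of_forall_rank true 2 k (7 - k) fun r _ hrk hr => ?_)
    rw [formDim, if_pos rfl]
    specialize hr rfl
    interval_cases k <;> interval_cases r <;> decide
  · obtain ⟨t, ht, htk⟩ := exists_not_hasIsotropicRows_seven
    exact ⟨t, ht, fun h' => htk (h'.mono (by omega))⟩

end main

theorem theorem4p14 (V : Type*) [AddCommGroup V] [Module ℂ V] [FiniteDimensional ℂ V]
    (n d k : ℕ) (hn : Module.finrank ℂ V = n) (hd : 1 ≤ d) (hk : 1 ≤ k) :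
    -- symmetric forms, general case
    (d ≠ 2 → HoldsGenerically fun w : SymForm d V =>
      (HasIsotropicSubspace (w : MultilinearMap ℂ (fun _ : Fin d => V) ℂ) k ↔
        (((d + k - 1).choose d : ℕ) : ℚ) / (k : ℚ) + (k : ℚ) ≤ (n : ℚ))) ∧
    -- symmetric forms of degree two
    (d = 2 → HoldsGenerically fun w : SymForm d V =>
      (HasIsotropicSubspace (w : MultilinearMap ℂ (fun _ : Fin d => V) ℂ) k ↔ 2 * k ≤ n)) ∧
    -- skew-symmetric forms, general case
    (d ≠ 2 → ¬ (d + 2 = n ∧ Even n) → ¬ (d = 3 ∧ n = 7) →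
      HoldsGenerically fun w : V [⋀^Fin d]→ₗ[ℂ] ℂ =>
        (HasIsotropicSubspace w.toMultilinearMap k ↔
          ((k.choose d : ℕ) : ℚ) / (k : ℚ) + (k : ℚ) ≤ (n : ℚ))) ∧
    -- skew-symmetric forms of degree two, in even dimension
    (d = 2 → Even n → HoldsGenerically fun w : V [⋀^Fin d]→ₗ[ℂ] ℂ =>
      (HasIsotropicSubspace w.toMultilinearMap k ↔ 2 * k ≤ n)) ∧
    -- skew-symmetric forms of degree two, in odd dimension
    (d = 2 → Odd n → HoldsGenerically fun w : V [⋀^Fin d]→ₗ[ℂ] ℂ =>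
      (HasIsotropicSubspace w.toMultilinearMap k ↔ 2 * k ≤ n + 1)) ∧
    -- skew-symmetric forms of degree `n - 2`, in even dimension
    (d + 2 = n → Even n → HoldsGenerically fun w : V [⋀^Fin d]→ₗ[ℂ] ℂ =>
      (HasIsotropicSubspace w.toMultilinearMap k ↔ k ≤ n - 2)) ∧
    -- skew-symmetric forms of degree three in dimension seven
    (d = 3 → n = 7 → HoldsGenerically fun w : V [⋀^Fin d]→ₗ[ℂ] ℂ =>
      (HasIsotropicSubspace w.toMultilinearMap k ↔ k ≤ 4)) := by
  refine ⟨fun h => SymForm.holdsGenerically_hasIsotropicSubspace_iff hn hd hk h, ?_,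
    fun h1 h2 h3 => AlternatingMap.holdsGenerically_hasIsotropicSubspace_iff hn hd hk h1 h2 h3,
    ?_, ?_, fun h1 h2 => AlternatingMap.holdsGenerically_corank_two hn hd h1 h2, ?_⟩
  · rintro rfl
    exact SymForm.holdsGenerically_two hn hk
  · rintro rfl h
    have := AlternatingMap.holdsGenerically_two (k := k) hn hk
    rwa [if_pos h] at this
  · rintro rfl h
    have := AlternatingMap.holdsGenerically_two (k := k) hn hk
    rwa [if_neg (Nat.not_even_iff_odd.mpr h)] at this
  · rintro rfl rfl
    exact AlternatingMap.holdsGenerically_three_of_finrank_eq_seven hn
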